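/- Let $n\ge 4$, and let $W$ be the finite Weyl group of type $D_n$, with simple reflections $s_1,\dots,s_n$ and Cartan matrix $(c_{ij})$ in Bourbaki's labelling (so $s_1,\dots,s_{n-1}$ generate a subgroup of type $A_{n-1}$, and node $n-2$ has valence three). It acts on the coroot lattice $R^\vee=\bigoplus_{i=1}^n\mathbb Z\alpha_i^\vee$ by $s_i(\alpha_j^\vee)=\alpha_j^\vee-c_{ij}\alpha_i^\vee$. Let $\beta=(\beta_1\ge\dots\ge\beta_p)$ and $\delta=(\delta_1\le\dots\le\delta_{2r})$ be (possibly empty) partitions with positive parts, $\delta$ having an even number of parts, such that $|\beta|+|\delta|=n$. Define elements of $W$ as follows. * $w_\beta=w_1^\beta\cdots w_p^\beta$, where $w_k^\beta=s_{j+1}s_{j+2}\cdots s_{j+\beta_k-1}$ with $j=\beta_1+\dots+\beta_{k-1}$ (trivial if $\beta_k=1$). If $|\beta|=n$ and all parts of $\beta$ are even, write $w_{\beta^+}=w_\beta$, and let $w_{\beta^-}$ be obtained by replacing $s_{n-1}$ by $s_n$ in this product. * $u_0=s_n$, $u_1=s_ns_{n-1}$, and $u_j=s_{n-j}u_{j-1}s_{n-j}$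 for $2\le j\le n-1$. For $2\le k\le 2r$ with $\delta_k\ge 2$, put $v_k=u_j\,s_{n-(j+1)}s_{n-(j+2)}\cdots s_{n-(j+\delta_k-1)}$ with $j=\delta_1+\dots+\delta_{k-1}$. * $w_\delta=1$ if $|\delta|=0$. If $\delta$ has exactly $\ell\ge1$ parts equal to $1$, then $w_\delta=(u_1\cdots u_{\ell-1})\,v_{\ell+1}v_{\ell+2}\cdots v_{2r}$ (so $w_\delta=u_1\cdots u_{2r-1}$ if all parts are $1$). If $|\delta|\geq 2$ and no part of $\delta$ is $1$, then $w_\delta=(u_0s_{n-2}s_{n-3}\cdots s_{n-(\delta_1-1)})\,v_2\cdots v_{2r}$. Put $w_{\beta,\delta}=w_\beta w_\delta$. Let $w_{\beta^\pm,\delta}$ denote $w_{\beta,\delta}$, or, when $|\delta|=0$ and all parts of $\beta$ are even, either one of $w_{\beta^+}$ and $w_{\beta^-}$. Write $\gcd(\beta_k,2)=\gcd(\beta_1,\dots,\beta_p,2)$, which is $2$ if $|\beta|=0$. Let $S$ be the Smith normal form over $\mathbb Z$ of $\mathrm{Id}-w_{\beta^\pm,\delta}$ acting on $R^\vee$; exponents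 below denote multiplicities. 1. If $\gcd(\beta_k,2)=2$, $|\delta|\ge2$, and all parts of $\delta$ have the same parity, then $S=\operatorname{diag}(1^{n-2r-p},2^{2r},0^p)$. 2. If $\gcd(\beta_k,2)=2$, $|\delta|\ge2$, and the parts of $\delta$ do not all have the same parity, then $S=\operatorname{diag}(1^{n-2r-p+1},2^{2r-2},4,0^p)$. 3. If $\gcd(\beta_k,2)=1$ and $|\delta|\ge2$, then $S=\operatorname{diag}(1^{n-2r-p+1},2^{2r-1},0^p)$. 4. If $|\delta|=0$ and $\beta=(1,\dots,1)$, then $w_{\beta,\delta}$ is trivial and $S=\operatorname{diag}(0^n)$. If $|\delta|=0$ and $\beta\ne(1,\dots,1)$, then $S=\operatorname{diag}(1^{n-p-1},\gcd(\beta_k,2),0^p)$. -/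

import Mathlib

namespace TypeD

/-- The coroot lattice `R^∨` of type `D_n`: the free `ℤ`-module on the simple coroots
`α_1^∨, …, α_n^∨`. The simple coroot `α_{i+1}^∨` is the standard basis vector with
index `i : Fin n`. -/
abbrev CorootLattice (n : ℕ) : Type := Fin n → ℤ

/-- The simple coroot with (zero-based) index `i`. -/
def simpleCoroot (n : ℕ) (i : Fin n) : CorootLattice n := Pi.single i 1

/-- The simple root with (zero-based) index `i`, as a functional on the coroot lattice:
on the simple coroot with index `j` it takes the value `c_{ij}`, where `c` is the Cartan matrix
of type `D_n` in Bourbaki's labelling. -/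
def simpleRoot (n : ℕ) (i : Fin n) : Module.Dual ℤ (CorootLattice n) :=
  (LinearMap.proj i).comp (CartanMatrix.D n).mulVecLin

theorem simpleRoot_simpleCoroot (n : ℕ) (i j : Fin n) :
    simpleRoot n i (simpleCoroot n j) = CartanMatrix.D n i j := by
  simp [simpleRoot, simpleCoroot]

theorem simpleRoot_simpleCoroot_self (n : ℕ) (i : Fin n) :
    simpleRoot n i (simpleCoroot n i) = 2 := by
  simp [simpleRoot_simpleCoroot]

/-- The simple reflection with (zero-based) index `i`:
it maps `x` to `x - ⟨x, α_i⟩ α_i^∨`, so the simple coroot `α_j^∨` to `α_j^∨ - c_{ij} α_i^∨`. -/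
def simpleReflection (n : ℕ) (i : Fin n) : CorootLattice n ≃ₗ[ℤ] CorootLattice n :=
  Module.reflection (simpleRoot_simpleCoroot_self n i)

/-- The Weyl group of type `D_n`, in its (faithful) action on the coroot lattice: the group
generated by the simple reflections. -/
def weylGroup (n : ℕ) : Subgroup (CorootLattice n ≃ₗ[ℤ] CorootLattice n) :=
  Subgroup.closure (Set.range (simpleReflection n))

/-- The simple reflection `s_i` with `1 ≤ i ≤ n`, as an element of the Weyl group, in the one-based
labelling in which `s_1, …, s_{n-1}` generate a subsystem of type `A_{n-1}` and the node `n - 2`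
has valence three. Indices outside `1, …, n` get the value `1`; they are never used below when
`|β| + |δ| = n`. -/
def s (n i : ℕ) : weylGroup n :=
  if h : 1 ≤ i ∧ i ≤ n then
    ⟨simpleReflection n ⟨i - 1, by omega⟩, Subgroup.subset_closure ⟨_, rfl⟩⟩
  else 1

/-- The product `s_{i_1} s_{i_2} ⋯ s_{i_k}` of simple reflections for the word
`[i_1, i_2, …, i_k]`. -/
def wordProd (n : ℕ) (l : List ℕ) : weylGroup n := (l.map (s n)).prod

/-- The partial sum `j_k = a_1 + ⋯ + a_{k-1}` of a partition, with zero-based part index: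
`partialSum a k` is the sum of the first `k` parts. -/
def partialSum (a : List ℕ) (k : ℕ) : ℕ := (a.take k).sum

/-- The word of `w_β`: for each part `β_k`, in order, the word
`j_k + 1, j_k + 2, …, j_k + (β_k - 1)`, where `j_k = β_1 + ⋯ + β_{k-1}`. -/
def wordBeta (β : List ℕ) : List ℕ :=
  (List.range β.length).flatMap fun k =>
    (List.range (β.getD k 0 - 1)).map fun i => partialSum β k + i + 1

/-- The element `w_β` (which is `w_{β^+}` when `|β| = n` and all parts of `β` are even). -/
def wBeta (n : ℕ) (β : List ℕ) : weylGroup n := wordProd n (wordBeta β)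

/-- The element `w_{β^-}`, obtained by replacing `s_{n-1}` by `s_n` in the word of `w_{β^+}`. -/
def wBetaMinus (n : ℕ) (β : List ℕ) : weylGroup n :=
  wordProd n ((wordBeta β).map fun i => if i = n - 1 then n else i)

/-- The elements `u_0 = s_n`, `u_1 = s_n s_{n-1}` and `u_j = s_{n-j} u_{j-1} s_{n-j}` for
`j ≥ 2`. -/
def u (n : ℕ) : ℕ → weylGroup n
  | 0 => s n n
  | 1 => s n n * s n (n - 1)
  | j + 2 => s n (n - (j + 2)) * u n (j + 1) * s n (n - (j + 2))

/-- The element `u_j s_{n-(j+1)} s_{n-(j+2)} ⋯ s_{n-(j+d-1)}` where `d` is the part of `δ` with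
zero-based index `k`, and `j` is the sum of the parts before it. -/
def v (n : ℕ) (δ : List ℕ) (k : ℕ) : weylGroup n :=
  u n (partialSum δ k) *
    wordProd n ((List.range (δ.getD k 0 - 1)).map fun i => n - (partialSum δ k + (i + 1)))

/-- The element `w_δ`, for a weakly increasing list `δ` of positive integers.
* If `δ` is empty, it is trivial.
* If `δ` has exactly `ℓ ≥ 1` parts equal to `1` (these come first), it is
  `(u_1 ⋯ u_{ℓ-1}) v_{ℓ+1} ⋯ v_{2r}`; when all parts are `1` this reads `u_1 ⋯ u_{2r-1}`.
* If no part of `δ` is `1`, it is `(u_0 s_{n-2} s_{n-3} ⋯ s_{n-(δ_1-1)}) v_2 ⋯ v_{2r}`. -/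
def wDelta (n : ℕ) (δ : List ℕ) : weylGroup n :=
  if δ = [] then 1
  else if δ.count 1 = 0 then
    (u n 0 * wordProd n ((List.range (δ.getD 0 0 - 2)).map fun i => n - (i + 2))) *
      ((List.range' 1 (δ.length - 1)).map (v n δ)).prod
  else
    ((List.range' 1 (δ.count 1 - 1)).map (u n)).prod *
      ((List.range' (δ.count 1) (δ.length - δ.count 1)).map (v n δ)).prod

/-- `w` is one of the conjugacy class representatives `w_{β^±,δ}` attached to `(β, δ)`. This is
`w_β w_δ`, and in the special case that `|δ| = 0` and all parts of `β` are even there are two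
representatives, `w_{β^+} = w_β` and `w_{β^-}`. -/
def IsClassRep (n : ℕ) (β δ : List ℕ) (w : weylGroup n) : Prop :=
  w = wBeta n β * wDelta n δ ∨
    (δ = [] ∧ (∀ b ∈ β, Even b) ∧ w = wBetaMinus n β)

/-- The matrix of `Id - w` in the basis of simple coroots. -/
def idSub (n : ℕ) (w : weylGroup n) : Matrix (Fin n) (Fin n) ℤ :=
  LinearMap.toMatrix' (LinearMap.id - (w : CorootLattice n ≃ₗ[ℤ] CorootLattice n).toLinearMap)

/-- `diag(d_1, …, d_n)` is the Smith normal form of the integer matrix `A`: the `d_i` are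
nonnegative integers with `d_1 ∣ d_2 ∣ ⋯ ∣ d_n`, and `U A V = diag(d_1, …, d_n)` for some
`U, V ∈ GL_n(ℤ)`. -/
def HasSmithNormalForm {n : ℕ} (A : Matrix (Fin n) (Fin n) ℤ) (d : List ℕ) : Prop :=
  d.length = n ∧ d.Pairwise (· ∣ ·) ∧
    ∃ U V : GL (Fin n) ℤ,
      (U : Matrix (Fin n) (Fin n) ℤ) * A * (V : Matrix (Fin n) (Fin n) ℤ) =
        Matrix.diagonal fun i : Fin n => (d.getD i 0 : ℤ)

/-- `gcd(β_1, …, β_p, 2)`. -/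
def gcdTwo (β : List ℕ) : ℕ := β.foldr Nat.gcd 2

/-- All parts of `δ` have the same parity. -/
def SameParity (δ : List ℕ) : Prop := ∀ a ∈ δ, ∀ b ∈ δ, a % 2 = b % 2

end TypeD

/-!
The coroot lattice of type `D_n` is the lattice of vectors of `ℤ^n` with even coordinate sum
(`corootEmb`), and there `w_{β,δ}` is a signed permutation: the parts of `β` are the lengths of its
positive cycles and the parts of `δ` those of its negative cycles (`realizes_wBeta`,
`exists_realizes_wDelta`). The element `w_{β^-}` is the conjugate of `w_{β^+}` by the negation of
`e_n`, which preserves the lattice.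

On all of `ℤ^n` the Smith normal form of `1 - w` is immediate. For a cycle
`e_0 ↦ e_1 ↦ ⋯ ↦ e_{m-1} ↦ ε e_0`, the map `1 - w` sends `e_i` to `e_i - e_{i+1}` for `i < m - 1`,
and `e_0 + ⋯ + e_{m-1}` to `(1 - ε) e_0`; these vectors form bases, so the diagonal entries are
`m - 1` times `1`, and `0` or `2` (`hasDiagonalForm_of_cycles`).

To pass to the sublattice of index two, only the parities of the coordinate sums of these basis
vectors matter. The source vectors `e_i` are odd and `e_0 + ⋯ + e_{m-1}` has the parity of `m`; the
target vectors `e_i - e_{i+1}` are even and `e_0` is odd. Simultaneous shears of both bases keep the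
form diagonal (`HasDiagonalForm.shear`), and they can be chosen such that exactly one source vector
and exactly one target vector remain odd. Doubling these two vectors gives bases of the coroot
lattice, which doubles one diagonal entry and halves another one
(`HasDiagonalForm.hasSmithNormalForm`). Which entries these are depends on the parities of the parts
of `β` and `δ`, and this is the source of the case distinction in the theorem.

Since `n` vectors that span `ℤ^n` form a basis, the proofs work with spanning families, and linear
independence never has to be shown.
-/

namespace TypeD

/-! ### The coroot lattice as the lattice of integer vectors with even coordinate sum -/

/-- The standard basis vector `e_i` of `ℤ^n`, with one-based index `i`. It is `0` when `i` is not
in `1, …, n`. -/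
def stdVec (n i : ℕ) : Fin n → ℤ := fun k => if k.1 + 1 = i then 1 else 0

/-- The simple coroot with zero-based index `i` as a vector of `ℤ^n`: `e_{i+1} - e_{i+2}` for
`i + 1 < n`, and `e_{n-1} + e_n` for the last one. -/
def corootVec (n : ℕ) (i : Fin n) : Fin n → ℤ :=
  if i.1 + 1 < n then stdVec n (i.1 + 1) - stdVec n (i.1 + 2)
  else stdVec n (n - 1) + stdVec n n

/-- The embedding of the coroot lattice into `ℤ^n`. -/
def corootEmb (n : ℕ) : CorootLattice n →ₗ[ℤ] (Fin n → ℤ) :=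
  Fintype.linearCombination ℤ (corootVec n)

theorem corootEmb_simpleCoroot (n : ℕ) (i : Fin n) :
    corootEmb n (simpleCoroot n i) = corootVec n i := by
  simp [corootEmb, simpleCoroot, Fintype.linearCombination_apply, Pi.single_apply]

theorem dotProduct_stdVec {n i : ℕ} (h1 : 1 ≤ i) (h2 : i ≤ n) (x : Fin n → ℤ) :
    x ⬝ᵥ stdVec n i = x ⟨i - 1, by omega⟩ := by
  have : stdVec n i = Pi.single ⟨i - 1, by omega⟩ 1 := by
    ext k
    simp only [stdVec, Pi.single_apply, Fin.ext_iff]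
    congr 1
    simp only [eq_iff_iff]
    omega
  rw [this]
  simp

theorem eq_sum_stdVec {n : ℕ} (x : Fin n → ℤ) : x = ∑ k : Fin n, x k • stdVec n (k.1 + 1) := by
  ext j
  simp only [Finset.sum_apply, Pi.smul_apply, stdVec, smul_eq_mul]
  rw [Finset.sum_eq_single j]
  · simp
  · intro b _ hb
    rw [if_neg, mul_zero]
    intro h
    exact hb (Fin.ext (by omega))
  · simp

theorem corootVec_dotProduct {n : ℕ} (hn : 4 ≤ n) (i j : Fin n) :
    corootVec n i ⬝ᵥ corootVec n j = CartanMatrix.D n i j := by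
  have hj := j.2
  have hi := i.2
  rw [corootVec.eq_def n j]
  split_ifs with h
  · rw [dotProduct_sub, dotProduct_stdVec (by omega) (by omega),
      dotProduct_stdVec (by omega) (by omega)]
    simp only [corootVec, CartanMatrix.D, Matrix.of_apply, Fin.ext_iff]
    split_ifs <;> simp [stdVec] <;> split_ifs <;> omega
  · rw [dotProduct_add, dotProduct_stdVec (by omega) (by omega),
      dotProduct_stdVec (by omega) (by omega)]
    simp only [corootVec, CartanMatrix.D, Matrix.of_apply, Fin.ext_iff]
    split_ifs <;> simp [stdVec] <;> split_ifs <;> omega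

/-- Twice the `j`-th fundamental weight, in the coordinates of `ℤ^n`. -/
def twiceWeight (n : ℕ) (j : Fin n) : Fin n → ℤ := fun k =>
  if j.1 + 2 < n then (if k ≤ j then 2 else 0)
  else if j.1 + 2 = n ∧ k.1 + 1 = n then -1 else 1

theorem twiceWeight_dotProduct_corootEmb {n : ℕ} (hn : 4 ≤ n) (j : Fin n) (x : CorootLattice n) :
    twiceWeight n j ⬝ᵥ corootEmb n x = 2 * x j := by
  have hj := j.2
  have key : ∀ i, twiceWeight n j ⬝ᵥ corootVec n i = if i = j then 2 else 0 := by
    intro i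
    have hi := i.2
    rw [corootVec]
    split_ifs with h h' h'
    all_goals
      first | rw [dotProduct_sub] | rw [dotProduct_add]
      rw [dotProduct_stdVec (by omega) (by omega), dotProduct_stdVec (by omega) (by omega)]
      simp only [twiceWeight, Fin.ext_iff, Fin.le_def] at *
      split_ifs <;> omega
  rw [corootEmb, Fintype.linearCombination_apply, dotProduct_sum]
  simp only [dotProduct_smul, key, smul_eq_mul, mul_ite, mul_zero]
  rw [Finset.sum_ite_eq' Finset.univ j, if_pos (Finset.mem_univ j), mul_comm]

theorem corootEmb_injective {n : ℕ} (hn : 4 ≤ n) : Function.Injective (corootEmb n) := by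
  intro x y h
  ext j
  have h1 := twiceWeight_dotProduct_corootEmb hn j x
  have h2 := twiceWeight_dotProduct_corootEmb hn j y
  rw [h] at h1
  omega

theorem stdVec_sub_mem_range {n : ℕ} (d : ℕ) (hd : d < n) :
    stdVec n (n - d) - stdVec n n ∈ LinearMap.range (corootEmb n) := by
  induction d with
  | zero => simp
  | succ d ih =>
    have h : corootVec n ⟨n - (d + 1) - 1, by omega⟩ =
        stdVec n (n - (d + 1)) - stdVec n (n - d) := by
      rw [corootVec, if_pos (by simp; omega)]
      congr 2 <;> simp <;> omega
    have := add_mem (LinearMap.mem_range.2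
      ⟨_, (corootEmb_simpleCoroot n ⟨n - (d + 1) - 1, by omega⟩).trans h⟩) (ih (by omega))
    rwa [sub_add_sub_cancel] at this

theorem exists_corootEmb_eq {n : ℕ} (hn : 4 ≤ n) (y : Fin n → ℤ) (hy : Even (∑ k, y k)) :
    ∃ x, corootEmb n x = y := by
  change y ∈ LinearMap.range (corootEmb n)
  have h2 : (2 : ℤ) • stdVec n n ∈ LinearMap.range (corootEmb n) := by
    have h := sub_mem (LinearMap.mem_range.2 ⟨_, corootEmb_simpleCoroot n ⟨n - 1, by omega⟩⟩)
      (LinearMap.mem_range.2 ⟨_, corootEmb_simpleCoroot n ⟨n - 2, by omega⟩⟩)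
    rw [corootVec, corootVec, if_neg (by simp; omega), if_pos (by simp; omega)] at h
    simp only [show n - 2 + 1 = n - 1 by omega, show n - 2 + 2 = n by omega] at h
    rwa [add_sub_sub_cancel, ← two_smul ℤ] at h
  have hsum : y = ∑ k : Fin n, y k • (stdVec n (k.1 + 1) - stdVec n n)
      + (∑ k, y k) • stdVec n n := by
    simp only [smul_sub, Finset.sum_sub_distrib, ← Finset.sum_smul, ← eq_sum_stdVec]
    simp
  rw [hsum]
  refine add_mem (sum_mem fun k _ => Submodule.smul_mem _ _ ?_) ?_
  · have := stdVec_sub_mem_range (n := n) (n - (k.1 + 1)) (by omega)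
    rwa [show n - (n - (k.1 + 1)) = k.1 + 1 by omega] at this
  · obtain ⟨m, hm⟩ := hy
    rw [hm, ← mul_two, mul_smul]
    exact Submodule.smul_mem _ _ h2

theorem even_sum_corootEmb {n : ℕ} (hn : 4 ≤ n) (x : CorootLattice n) :
    Even (∑ k, corootEmb n x k) := by
  have h := twiceWeight_dotProduct_corootEmb hn ⟨n - 1, by omega⟩ x
  have h1 : twiceWeight n ⟨n - 1, by omega⟩ = 1 := by
    ext k
    simp only [twiceWeight, Pi.one_apply]
    rw [if_neg (by omega), if_neg (by omega)]
  rw [h1, one_dotProduct] at h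
  exact ⟨_, h.trans (two_mul _)⟩

/-! ### Weyl group elements as signed permutations -/

/-- The endomorphism `T` of `ℤ^n` restricts to `w` on the coroot lattice. -/
def Realizes {n : ℕ} (w : weylGroup n) (T : Module.End ℤ (Fin n → ℤ)) : Prop :=
  ∀ x, corootEmb n ((w : CorootLattice n ≃ₗ[ℤ] CorootLattice n) x) = T (corootEmb n x)

theorem Realizes.one {n : ℕ} : Realizes (1 : weylGroup n) 1 := fun _ => rfl

theorem Realizes.mul {n : ℕ} {w w' : weylGroup n} {T T' : Module.End ℤ (Fin n → ℤ)}
    (h : Realizes w T) (h' : Realizes w' T') : Realizes (w * w') (T * T') := by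
  intro x
  have h1 := h ((w' : CorootLattice n ≃ₗ[ℤ] CorootLattice n) x)
  rw [h' x] at h1
  exact h1

/-- The reflection in the simple coroot with one-based index `i`, on all of `ℤ^n`. It is the
identity when `i` is not in `1, …, n`. -/
def refl (n i : ℕ) : Module.End ℤ (Fin n → ℤ) :=
  if h : 1 ≤ i ∧ i ≤ n then
    LinearMap.id - (dotProductBilin ℤ ℤ (corootVec n ⟨i - 1, by omega⟩)).smulRight
      (corootVec n ⟨i - 1, by omega⟩)
  else 1

theorem refl_apply {n i : ℕ} (h1 : 1 ≤ i) (h2 : i ≤ n) (x : Fin n → ℤ) :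
    refl n i x = x - (corootVec n ⟨i - 1, by omega⟩ ⬝ᵥ x) • corootVec n ⟨i - 1, by omega⟩ := by
  simp [refl, h1, h2]

theorem realizes_s {n : ℕ} (hn : 4 ≤ n) (i : ℕ) : Realizes (s n i) (refl n i) := by
  by_cases h : 1 ≤ i ∧ i ≤ n
  swap
  · rw [s, refl, dif_neg h, dif_neg h]
    exact Realizes.one
  intro x
  rw [refl_apply h.1 h.2, s, dif_pos h]
  simp only [simpleReflection, Module.reflection_apply, map_sub, map_smul, corootEmb_simpleCoroot]
  congr 2
  rw [corootEmb, Fintype.linearCombination_apply, dotProduct_sum]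
  simp only [dotProduct_smul, corootVec_dotProduct hn, smul_eq_mul]
  simp [simpleRoot, Matrix.mulVec, dotProduct, mul_comm]

theorem refl_stdVec {n i z : ℕ} (hi : 1 ≤ i) (hin : i < n) (hz : 1 ≤ z) (hzn : z ≤ n) :
    refl n i (stdVec n z) =
      stdVec n (if z = i then i + 1 else if z = i + 1 then i else z) := by
  rw [refl_apply hi hin.le, dotProduct_stdVec hz hzn, corootVec, if_pos (by simp; omega)]
  simp only [show i - 1 + 1 = i by omega, show i - 1 + 2 = i + 1 by omega]
  ext k
  simp only [stdVec, Pi.sub_apply, Pi.smul_apply, smul_eq_mul]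
  grind

theorem refl_last_stdVec {n z : ℕ} (hn : 2 ≤ n) (hz : 1 ≤ z) (hzn : z ≤ n) :
    refl n n (stdVec n z) =
      if z = n then -stdVec n (n - 1) else if z = n - 1 then -stdVec n n else stdVec n z := by
  rw [refl_apply (by omega) le_rfl, dotProduct_stdVec hz hzn, corootVec, if_neg (by simp; omega)]
  ext k
  split_ifs <;>
  simp only [stdVec, Pi.sub_apply, Pi.add_apply, Pi.neg_apply, Pi.smul_apply, smul_eq_mul] <;>
  grind

theorem realizes_wordProd {n : ℕ} (hn : 4 ≤ n) (l : List ℕ) :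
    Realizes (wordProd n l) (l.map (refl n)).prod := by
  induction l with
  | nil => exact Realizes.one
  | cons a l ih =>
    simp only [wordProd, List.map_cons, List.prod_cons]
    exact (realizes_s hn a).mul ih

/-- An ascending product of reflections is a cycle on consecutive indices. -/
theorem ascending_prod_stdVec {n j : ℕ} (m : ℕ) (hm : j + m < n) {z : ℕ} (hz : 1 ≤ z)
    (hzn : z ≤ n) :
    (((List.range m).map fun i => j + i + 1).map (refl n)).prod (stdVec n z) =
      stdVec n (if j < z ∧ z ≤ j + m then z + 1 else if z = j + m + 1 then j + 1 else z) := by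
  induction m generalizing z with
  | zero => simp; grind
  | succ m ih =>
    rw [List.range_succ, List.map_append, List.map_append, List.prod_append]
    simp only [List.map_cons, List.map_nil, List.prod_singleton, Module.End.mul_apply]
    rw [refl_stdVec (by omega) (by omega) hz hzn, ih (by omega) (by grind) (by grind)]
    grind

/-- A descending product of reflections is a cycle on consecutive indices. -/
theorem descending_prod_stdVec {n j : ℕ} (m : ℕ) (hm : j + m < n) {z : ℕ} (hz : 1 ≤ z)
    (hzn : z ≤ n) :
    (((List.range m).map fun i => n - (j + (i + 1))).map (refl n)).prod (stdVec n z) =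
      stdVec n (if n - (j + m) < z ∧ z ≤ n - j then z - 1
        else if z = n - (j + m) then n - j else z) := by
  induction m generalizing z with
  | zero => simp; grind
  | succ m ih =>
    rw [List.range_succ, List.map_append, List.map_append, List.prod_append]
    simp only [List.map_cons, List.map_nil, List.prod_singleton, Module.End.mul_apply]
    rw [refl_stdVec (by omega) (by omega) hz hzn, ih (by omega) (by grind) (by grind)]
    grind

/-- `u_j` negates `e_{n-j}` and `e_n`. -/
theorem exists_realizes_u {n : ℕ} (hn : 4 ≤ n) {j : ℕ} (hj : 1 ≤ j) (hjn : j < n) :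
    ∃ T, Realizes (u n j) T ∧ ∀ z, 1 ≤ z → z ≤ n →
      T (stdVec n z) = if z = n ∨ z = n - j then -stdVec n z else stdVec n z := by
  induction j, hj using Nat.le_induction with
  | base =>
    refine ⟨_, (realizes_s hn n).mul (realizes_s hn (n - 1)), fun z hz hzn => ?_⟩
    rw [Module.End.mul_apply, refl_stdVec (by omega) (by omega) hz hzn,
      refl_last_stdVec (by omega) (by grind) (by grind)]
    grind
  | succ j hj ih =>
    obtain ⟨T, hT, hTz⟩ := ih (by omega)
    obtain ⟨j, rfl⟩ : ∃ i, j = i + 1 := ⟨j - 1, by omega⟩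
    refine ⟨_, ((realizes_s hn (n - (j + 2))).mul hT).mul (realizes_s hn (n - (j + 2))),
      fun z hz hzn => ?_⟩
    rw [Module.End.mul_apply, Module.End.mul_apply, refl_stdVec (by omega) (by omega) hz hzn,
      hTz _ (by grind) (by grind), apply_ite (refl n (n - (j + 2))), map_neg,
      refl_stdVec (by omega) (by omega) (by grind) (by grind)]
    grind

/-! ### The action of the class representatives -/

theorem partialSum_succ (a : List ℕ) (k : ℕ) :
    partialSum a (k + 1) = partialSum a k + a.getD k 0 := by
  rw [partialSum, List.take_add_one, List.sum_append, partialSum, List.getD_eq_getElem?_getD]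
  cases a[k]? <;> simp

theorem partialSum_mono (a : List ℕ) : Monotone (partialSum a) :=
  monotone_nat_of_le_succ fun k => by rw [partialSum_succ]; omega

theorem partialSum_length (a : List ℕ) : partialSum a a.length = a.sum := by simp [partialSum]

theorem partialSum_le_sum (a : List ℕ) (k : ℕ) : partialSum a k ≤ a.sum := by
  rcases le_total k a.length with h | h
  · rw [← partialSum_length]
    exact partialSum_mono a h
  · simp [partialSum, List.take_of_length_le h]

/-- The block of a partition that follows its first `k` parts stays below the total. -/
theorem partialSum_add_le {a : List ℕ} (k : ℕ) : partialSum a k + a.getD k 0 ≤ a.sum := by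
  rw [← partialSum_succ]
  exact partialSum_le_sum a _

/-- `w_β` permutes the indices of each block of `β` in an ascending cycle. -/
theorem realizes_wBeta {n : ℕ} (hn : 4 ≤ n) {β : List ℕ} (hpos : ∀ b ∈ β, 1 ≤ b)
    (hsum : β.sum ≤ n) :
    Realizes (wBeta n β) ((wordBeta β).map (refl n)).prod ∧
    (∀ k < β.length, ∀ i < β.getD k 0,
      ((wordBeta β).map (refl n)).prod (stdVec n (partialSum β k + i + 1)) =
        stdVec n (if i + 1 < β.getD k 0 then partialSum β k + i + 2 else partialSum β k + 1)) ∧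
    ∀ z, β.sum < z → z ≤ n → ((wordBeta β).map (refl n)).prod (stdVec n z) = stdVec n z := by
  refine ⟨realizes_wordProd hn _, ?_⟩
  have key : ∀ K ≤ β.length, ∀ T : Module.End ℤ (Fin n → ℤ),
      T = (((List.range K).flatMap fun k =>
        (List.range (β.getD k 0 - 1)).map fun i => partialSum β k + i + 1).map (refl n)).prod →
      (∀ k < K, ∀ i < β.getD k 0, T (stdVec n (partialSum β k + i + 1)) =
        stdVec n (if i + 1 < β.getD k 0 then partialSum β k + i + 2 else partialSum β k + 1)) ∧
      ∀ z, partialSum β K < z → z ≤ n → T (stdVec n z) = stdVec n z := by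
    intro K
    induction K with
    | zero =>
      rintro - T rfl
      simp
    | succ K ih =>
      rintro hK T rfl
      obtain ⟨ih1, ih2⟩ := ih (by omega) _ rfl
      have hb : 1 ≤ β.getD K 0 := by
        rw [List.getD_eq_getElem _ _ (by omega)]
        exact hpos _ (List.getElem_mem _)
      have hle := partialSum_add_le (a := β) K
      rw [partialSum_succ, List.range_succ, List.flatMap_append, List.map_append, List.prod_append]
      simp only [List.flatMap_cons, List.flatMap_nil, List.append_nil, Module.End.mul_apply]
      generalize (((List.range K).flatMap fun k =>
        (List.range (β.getD k 0 - 1)).map fun i => partialSum β k + i + 1).map (refl n)).prod = T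
        at ih1 ih2 ⊢
      refine ⟨fun k hk i hi => ?_, fun z hz hzn => ?_⟩
      · rcases Nat.lt_succ_iff_lt_or_eq.1 hk with h | rfl
        · have hle' := partialSum_mono β (Nat.succ_le_of_lt h)
          rw [Nat.succ_eq_add_one, partialSum_succ] at hle'
          rw [ascending_prod_stdVec _ (by omega) (by omega) (by omega), if_neg (by omega),
            if_neg (by omega), ih1 k h i hi]
        · rw [ascending_prod_stdVec _ (by omega) (by omega) (by omega),
            ih2 _ (by grind) (by grind)]
          grind
      · rw [ascending_prod_stdVec _ (by omega) (by omega) (by omega), if_neg (by omega),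
          if_neg (by omega), ih2 _ (by omega) hzn]
  have := key β.length le_rfl _ rfl
  rwa [partialSum_length] at this

/-- `v_k` acts on the block of `δ_k` as a negative cycle, and negates `e_n` as well. -/
theorem exists_realizes_v {n : ℕ} (hn : 4 ≤ n) {δ : List ℕ} (hsum : δ.sum ≤ n) {k : ℕ}
    (hk : 1 ≤ partialSum δ k) (hpos : 1 ≤ δ.getD k 0) :
    ∃ T, Realizes (v n δ k) T ∧ T (stdVec n n) = -stdVec n n ∧
      (∀ i < δ.getD k 0, T (stdVec n (n - (partialSum δ k + i))) =
        if i + 1 < δ.getD k 0 then stdVec n (n - (partialSum δ k + i + 1))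
        else -stdVec n (n - partialSum δ k)) ∧
      ∀ z, 1 ≤ z → z < n → (n - partialSum δ k < z ∨ z ≤ n - partialSum δ (k + 1)) →
        T (stdVec n z) = stdVec n z := by
  have hle := partialSum_add_le (a := δ) k
  obtain ⟨U, hU, hUz⟩ := exists_realizes_u hn hk (show partialSum δ k < n by omega)
  rw [partialSum_succ]
  refine ⟨_, hU.mul (realizes_wordProd hn _), ?_, fun i hi => ?_, fun z hz hzn h => ?_⟩
  · rw [Module.End.mul_apply, descending_prod_stdVec _ (by omega) (by omega) (by omega),
      hUz _ (by grind) (by grind)]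
    grind
  · rw [Module.End.mul_apply, descending_prod_stdVec _ (by omega) (by omega) (by omega),
      hUz _ (by grind) (by grind)]
    grind
  · rw [Module.End.mul_apply, descending_prod_stdVec _ (by omega) (by omega) (by omega),
      hUz _ (by grind) (by grind)]
    grind

/-- The parts equal to `1` come first in an increasing list of positive integers. -/
theorem getD_eq_one_of_lt_count {δ : List ℕ} (hpos : ∀ d ∈ δ, 1 ≤ d)
    (hincr : δ.Pairwise (· ≤ ·)) {k : ℕ} (hk : k < δ.count 1) : δ.getD k 0 = 1 := by
  induction δ generalizing k with
  | nil => simp at hk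
  | cons a l ih =>
    obtain ⟨h1, h2⟩ := List.pairwise_cons.1 hincr
    by_cases ha : a = 1
    · subst ha
      cases k with
      | zero => simp
      | succ k =>
        rw [List.count_cons_self] at hk
        simpa using ih (fun d hd => hpos d (List.mem_cons_of_mem _ hd)) h2 (by omega)
    · exfalso
      have : 1 ∈ l := List.count_pos_iff.1 (by rw [List.count_cons_of_ne ha] at hk; omega)
      have := h1 _ this
      have := hpos a List.mem_cons_self
      omega

theorem partialSum_eq_self {δ : List ℕ} (hpos : ∀ d ∈ δ, 1 ≤ d)
    (hincr : δ.Pairwise (· ≤ ·)) {k : ℕ} (hk : k ≤ δ.count 1) : partialSum δ k = k := by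
  induction k with
  | zero => rfl
  | succ k ih =>
    rw [partialSum_succ, ih (by omega), getD_eq_one_of_lt_count hpos hincr (by omega)]

/-- The contribution of the first part of `δ` to `w_δ`. -/
def firstBlock (n : ℕ) (δ : List ℕ) : weylGroup n :=
  if δ.getD 0 0 = 1 then 1
  else u n 0 * wordProd n ((List.range (δ.getD 0 0 - 2)).map fun i => n - (i + 2))

/-- The two cases in the definition of `w_δ` fit one formula, because `v_k = u_{k-1}` for each
part `δ_k = 1` with `k ≥ 2`. -/
theorem wDelta_eq {n : ℕ} {δ : List ℕ} (hne : δ ≠ []) (hpos : ∀ d ∈ δ, 1 ≤ d)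
    (hincr : δ.Pairwise (· ≤ ·)) :
    wDelta n δ = firstBlock n δ * ((List.range' 1 (δ.length - 1)).map (v n δ)).prod := by
  rw [wDelta, if_neg hne, firstBlock]
  have hlen : 0 < δ.length := List.length_pos_iff.2 hne
  by_cases hc : δ.count 1 = 0
  · rw [if_pos hc, if_neg]
    rw [List.getD_eq_getElem _ _ hlen]
    intro h
    exact List.count_eq_zero.1 hc (h ▸ List.getElem_mem hlen)
  · rw [if_neg hc, if_pos (getD_eq_one_of_lt_count hpos hincr (by omega)), one_mul]
    have hle : δ.count 1 ≤ δ.length := List.count_le_length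
    have hsplit : List.range' 1 (δ.length - 1) =
        List.range' 1 (δ.count 1 - 1) ++ List.range' (δ.count 1) (δ.length - δ.count 1) := by
      have h := List.range'_append_1 (s := 1) (m := δ.count 1 - 1) (n := δ.length - δ.count 1)
      rw [show 1 + (δ.count 1 - 1) = δ.count 1 by omega,
        show δ.count 1 - 1 + (δ.length - δ.count 1) = δ.length - 1 by omega] at h
      exact h.symm
    rw [hsplit, List.map_append, List.prod_append]
    congr 2
    refine List.map_congr_left fun k hk => ?_
    rw [List.mem_range'_1] at hk
    rw [v, partialSum_eq_self hpos hincr (by omega), getD_eq_one_of_lt_count hpos hincr (by omega)]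
    exact (mul_one _).symm

/-- The first block is a cycle of `e_n, e_{n-1}, …` with the sign of the image of `e_n` opposite to
the one in a negative cycle. -/
theorem exists_realizes_firstBlock {n : ℕ} (hn : 4 ≤ n) {δ : List ℕ} (hsum : δ.sum ≤ n)
    (hpos : 1 ≤ δ.getD 0 0) :
    ∃ T, Realizes (firstBlock n δ) T ∧
      (∀ i < δ.getD 0 0, T (stdVec n (n - i)) =
        (if i = 0 then (-1 : ℤ) else 1) • if i + 1 < δ.getD 0 0 then stdVec n (n - (i + 1))
        else -stdVec n n) ∧
      ∀ z, 1 ≤ z → z ≤ n - δ.getD 0 0 → T (stdVec n z) = stdVec n z := by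
  have hle := partialSum_add_le (a := δ) 0
  rw [firstBlock]
  split_ifs with h
  · refine ⟨1, Realizes.one, fun i hi => ?_, fun z hz hzn => rfl⟩
    obtain rfl : i = 0 := by omega
    rw [if_pos rfl, if_neg (by omega)]
    simp
  · refine ⟨_, (realizes_s hn n).mul (realizes_wordProd hn _), ?_⟩
    have hw : ((List.range (δ.getD 0 0 - 2)).map fun i => n - (i + 2)) =
        (List.range (δ.getD 0 0 - 2)).map fun i => n - (1 + (i + 1)) :=
      List.map_congr_left fun i _ => by omega
    rw [hw]
    refine ⟨fun i hi => ?_, fun z hz hzn => ?_⟩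
    · rw [Module.End.mul_apply, descending_prod_stdVec _ (by omega) (by omega) (by omega),
        refl_last_stdVec (by omega) (by grind) (by grind)]
      by_cases h0 : i = 0
      · subst h0
        rw [if_pos rfl, neg_one_smul]
        grind
      · rw [if_neg h0, one_smul]
        grind
    · rw [Module.End.mul_apply, descending_prod_stdVec _ (by omega) (by omega) (by omega),
        refl_last_stdVec (by omega) (by grind) (by grind)]
      grind

/-- `w_δ` acts on each block of `δ` as a negative cycle. The number of parts is even, so the factors
`v_k` with `k ≥ 2` together negate `e_n`, which makes the first block a negative cycle too. -/
theorem exists_realizes_wDelta {n : ℕ} (hn : 4 ≤ n) {δ : List ℕ} (hpos : ∀ d ∈ δ, 1 ≤ d)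
    (hincr : δ.Pairwise (· ≤ ·)) (heven : Even δ.length) (hsum : δ.sum ≤ n) :
    ∃ T, Realizes (wDelta n δ) T ∧
      (∀ k < δ.length, ∀ i < δ.getD k 0, T (stdVec n (n - (partialSum δ k + i))) =
        if i + 1 < δ.getD k 0 then stdVec n (n - (partialSum δ k + i + 1))
        else -stdVec n (n - partialSum δ k)) ∧
      ∀ z, 1 ≤ z → z ≤ n - δ.sum → T (stdVec n z) = stdVec n z := by
  by_cases hne : δ = []
  · subst hne
    exact ⟨1, by rw [wDelta, if_pos rfl]; exact Realizes.one, by simp, fun _ _ _ => rfl⟩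
  have hlen : 0 < δ.length := List.length_pos_iff.2 hne
  have hb : ∀ k < δ.length, 1 ≤ δ.getD k 0 := fun k hk => by
    rw [List.getD_eq_getElem _ _ hk]
    exact hpos _ (List.getElem_mem _)
  -- After `K + 1` blocks, the image of `e_n` carries the extra sign `(-1)^(K + 1)`.
  have key : ∀ K < δ.length, ∃ T,
      Realizes (firstBlock n δ * ((List.range' 1 K).map (v n δ)).prod) T ∧
      (∀ k ≤ K, ∀ i < δ.getD k 0, T (stdVec n (n - (partialSum δ k + i))) =
        (if partialSum δ k + i = 0 then (-1 : ℤ) ^ (K + 1) else 1) •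
          if i + 1 < δ.getD k 0 then stdVec n (n - (partialSum δ k + i + 1))
          else -stdVec n (n - partialSum δ k)) ∧
      ∀ z, 1 ≤ z → z ≤ n - partialSum δ (K + 1) → T (stdVec n z) = stdVec n z := by
    intro K
    induction K with
    | zero =>
      intro _
      obtain ⟨T, hT, h1, h2⟩ := exists_realizes_firstBlock hn hsum (hb 0 hlen)
      refine ⟨T, by simpa using hT, fun k hk i hi => ?_, fun z hz hzn => ?_⟩
      · obtain rfl : k = 0 := by omega
        simpa [partialSum] using h1 i hi
      · rw [partialSum_succ] at hzn
        exact h2 z hz (by omega)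
    | succ K ih =>
      intro hK
      obtain ⟨T, hT, h1, h2⟩ := ih (by omega)
      have hQ : 1 ≤ partialSum δ (K + 1) := by
        have := hb 0 hlen
        have h := partialSum_mono δ (show 1 ≤ K + 1 by omega)
        rw [partialSum_succ δ 0] at h
        omega
      obtain ⟨V, hV, hV1, hV2, hV3⟩ := exists_realizes_v hn hsum hQ (hb _ hK)
      refine ⟨T * V, ?_, fun k hk i hi => ?_, fun z hz hzn => ?_⟩
      · rw [List.range'_1_concat, List.map_append, List.prod_append, ← mul_assoc]
        have := hT.mul hV
        rwa [add_comm K 1] at this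
      · rcases (show k ≤ K ∨ k = K + 1 by omega) with h | rfl
        · have hle := partialSum_mono δ (show k + 1 ≤ K + 1 by omega)
          have hle' := partialSum_le_sum δ (K + 1)
          rw [partialSum_succ] at hle
          have hT' := h1 k h i hi
          by_cases h0 : partialSum δ k + i = 0
          · rw [if_pos h0] at hT' ⊢
            rw [h0, Nat.sub_zero] at hT' ⊢
            rw [Module.End.mul_apply, hV1, map_neg, hT', pow_succ _ (K + 1), mul_neg_one, neg_smul]
          · rw [if_neg h0] at hT' ⊢
            rw [Module.End.mul_apply, hV3 _ (by omega) (by omega) (by omega), hT']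
        · have hle := partialSum_le_sum δ (K + 2)
          rw [partialSum_succ] at hle
          rw [if_neg (show ¬partialSum δ (K + 1) + i = 0 by omega), one_smul,
            Module.End.mul_apply, hV2 i hi]
          split_ifs
          · rw [h2 _ (by omega) (by omega)]
          · rw [map_neg, h2 _ (by omega) le_rfl]
      · have hle := partialSum_mono δ (show K + 1 ≤ K + 1 + 1 by omega)
        rw [Module.End.mul_apply, hV3 z hz (by omega) (Or.inr hzn), h2 z hz (by omega)]
  obtain ⟨T, hT, h1, h2⟩ := key (δ.length - 1) (by omega)
  rw [show δ.length - 1 + 1 = δ.length by omega] at h1 h2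
  rw [partialSum_length] at h2
  refine ⟨T, by rwa [wDelta_eq hne hpos hincr], fun k hk i hi => ?_, h2⟩
  rw [h1 k (by omega) i hi, heven.neg_one_pow, ite_self, one_smul]

/-! ### Smith normal forms from spanning families -/

/-- Families with the same multiset of values differ by a bijection of their index types. -/
theorem exists_equiv_of_map_eq {I J α : Type*} [Fintype I] [Fintype J] [DecidableEq α]
    {f : I → α} {g : J → α}
    (h : Multiset.map f Finset.univ.val = Multiset.map g Finset.univ.val) :
    ∃ e : J ≃ I, ∀ j, f (e j) = g j := by
  have hcard : ∀ a, Fintype.card {j // g j = a} = Fintype.card {i // f i = a} := by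
    intro a
    have := congrArg (Multiset.count a) h
    simp only [Multiset.count_map, eq_comm (a := a)] at this
    rw [Fintype.card_subtype, Fintype.card_subtype]
    exact this.symm
  refine ⟨(Equiv.sigmaFiberEquiv g).symm.trans ((Equiv.sigmaCongrRight fun a =>
    Fintype.equivOfCardEq (hcard a)).trans (Equiv.sigmaFiberEquiv f)), fun j => ?_⟩
  exact ((Fintype.equivOfCardEq (hcard (g j))) ⟨j, rfl⟩).2

/-- The matrix whose columns are a spanning family of `n` vectors of `ℤ^n` is invertible. -/
theorem exists_GL_of_span {n : ℕ} {b : Fin n → Fin n → ℤ}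
    (hb : ⊤ ≤ Submodule.span ℤ (Set.range b)) :
    ∃ V : GL (Fin n) ℤ, (V : Matrix (Fin n) (Fin n) ℤ) = (Matrix.of b).transpose := by
  have h : ∀ j : Fin n, ∃ c : Fin n → ℤ, ∑ i, c i • b i = Pi.single j 1 := fun j =>
    (Submodule.mem_span_range_iff_exists_fun ℤ).1 (hb trivial)
  choose c hc using h
  have hmul : (Matrix.of b).transpose * (Matrix.of c).transpose = 1 := by
    ext k j
    have := congrFun (hc j) k
    simp only [Finset.sum_apply, Pi.smul_apply, smul_eq_mul, Pi.single_apply] at this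
    simp only [Matrix.mul_apply, Matrix.transpose_apply, Matrix.of_apply, Matrix.one_apply]
    rw [← this]
    exact Finset.sum_congr rfl fun i _ => mul_comm _ _
  exact ⟨⟨_, _, hmul, mul_eq_one_comm.1 hmul⟩, rfl⟩

theorem hasSmithNormalForm_of_span {n : ℕ} {I : Type*} [Fintype I] {A : Matrix (Fin n) (Fin n) ℤ}
    {b c : I → Fin n → ℤ} (hb : ⊤ ≤ Submodule.span ℤ (Set.range b))
    (hc : ⊤ ≤ Submodule.span ℤ (Set.range c)) {d : I → ℤ} (h : ∀ i, A.mulVec (b i) = d i • c i)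
    {L : List ℕ} (hlen : L.length = n) (hdvd : L.Pairwise (· ∣ ·))
    (hL : Multiset.map d Finset.univ.val = ((L.map Nat.cast : List ℤ) : Multiset ℤ)) :
    HasSmithNormalForm A L := by
  refine ⟨hlen, hdvd, ?_⟩
  obtain ⟨e, he⟩ : ∃ e : Fin n ≃ I, ∀ k, d (e k) = (L.getD k 0 : ℤ) := by
    refine exists_equiv_of_map_eq (hL.trans ?_)
    rw [Fin.univ_val_map]
    congr 1
    subst hlen
    refine List.ext_getElem (by simp) fun k h1 h2 => ?_
    simp only [List.length_map] at h1
    simp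
  obtain ⟨V, hV⟩ := exists_GL_of_span (b := b ∘ e) (by rwa [e.surjective.range_comp])
  obtain ⟨C, hC⟩ := exists_GL_of_span (b := c ∘ e) (by rwa [e.surjective.range_comp])
  refine ⟨C⁻¹, V, ?_⟩
  have key : A * V = C * Matrix.diagonal fun k : Fin n => (L.getD k 0 : ℤ) := by
    ext k j
    have := congrFun (h (e j)) k
    rw [Matrix.mul_diagonal, hV, hC]
    simpa [Matrix.mul_apply, Matrix.mulVec, dotProduct, he, mul_comm] using this
  rw [mul_assoc, key, ← mul_assoc, ← Units.val_mul, inv_mul_cancel, Units.val_one, one_mul]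

/-- The parity of the coordinate sum of an integer vector. The coroot lattice is its kernel. -/
def parity (n : ℕ) : (Fin n → ℤ) →+ ZMod 2 :=
  (Int.castAddHom (ZMod 2)).comp
    (AddMonoidHom.mk' (fun x => ∑ k, x k) fun _ _ => Finset.sum_add_distrib)

theorem parity_apply {n : ℕ} (x : Fin n → ℤ) : parity n x = ((∑ k, x k : ℤ) : ZMod 2) := rfl

theorem parity_smul {n : ℕ} (c : ℤ) (x : Fin n → ℤ) :
    parity n (c • x) = (c : ZMod 2) * parity n x := by
  rw [map_zsmul, zsmul_eq_mul]

theorem parity_eq_zero_iff {n : ℕ} (x : Fin n → ℤ) : parity n x = 0 ↔ Even (∑ k, x k) := by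
  rw [parity_apply, ZMod.intCast_eq_zero_iff_even]

/-- If all members of a spanning family of `ℤ^n` but the one at `i₀` have even coordinate sum, then
the family becomes a spanning family of the coroot lattice when that member is doubled. -/
theorem exists_span_corootLattice {n : ℕ} (hn : 4 ≤ n) {I : Type*} [Fintype I] [DecidableEq I]
    {E : I → Fin n → ℤ} (hE : ⊤ ≤ Submodule.span ℤ (Set.range E)) (i₀ : I)
    (hpar : ∀ i, parity n (E i) = if i = i₀ then 1 else 0) :
    ∃ b : I → CorootLattice n, ⊤ ≤ Submodule.span ℤ (Set.range b) ∧
      ∀ i, corootEmb n (b i) = (if i = i₀ then 2 else 1 : ℤ) • E i := by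
  have hex : ∀ i, ∃ x, corootEmb n x = (if i = i₀ then 2 else 1 : ℤ) • E i := by
    intro i
    refine exists_corootEmb_eq hn _ ((parity_eq_zero_iff _).1 ?_)
    rw [parity_smul, hpar]
    split_ifs
    · rw [mul_one]; decide
    · simp
  choose b hb using hex
  refine ⟨b, fun x _ => ?_, hb⟩
  obtain ⟨c, hc⟩ := (Submodule.mem_span_range_iff_exists_fun ℤ).1
    (hE (show corootEmb n x ∈ ⊤ from trivial))
  have hx := (parity_eq_zero_iff _).2 (even_sum_corootEmb hn x)
  rw [← hc, map_sum] at hx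
  simp only [parity_smul, hpar, mul_ite, mul_one, mul_zero, Finset.sum_ite_eq', Finset.mem_univ,
    if_true] at hx
  obtain ⟨m, hm⟩ := (ZMod.intCast_eq_zero_iff_even).1 hx
  refine (Submodule.mem_span_range_iff_exists_fun ℤ).2
    ⟨fun i => if i = i₀ then m else c i, corootEmb_injective hn ?_⟩
  rw [← hc, map_sum]
  refine Finset.sum_congr rfl fun i _ => ?_
  rw [map_smul, hb, smul_smul]
  dsimp only
  split_ifs with h
  · rw [h, hm, mul_two]
  · rw [mul_one]

/-- The endomorphism `D` of `ℤ^n` is diagonal with entries `d` with respect to a spanning family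
in the source and one in the target, whose members have the parities `a` and `b`. When there are
`n` indices, which is the only case in use, spanning families are bases. -/
def HasDiagonalForm {n : ℕ} {I : Type*} (D : Module.End ℤ (Fin n → ℤ)) (d : I → ℤ)
    (a b : I → ZMod 2) : Prop :=
  ∃ E F : I → Fin n → ℤ, ⊤ ≤ Submodule.span ℤ (Set.range E) ∧
    ⊤ ≤ Submodule.span ℤ (Set.range F) ∧ (∀ i, D (E i) = d i • F i) ∧
    (∀ i, parity n (E i) = a i) ∧ ∀ i, parity n (F i) = b i

theorem span_add_smul {M I : Type*} [AddCommGroup M] {E : I → M}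
    (hE : ⊤ ≤ Submodule.span ℤ (Set.range E)) {i₀ : I} {c : I → ℤ} (hc : c i₀ = 0) :
    ⊤ ≤ Submodule.span ℤ (Set.range fun i => E i + c i • E i₀) := by
  refine hE.trans (Submodule.span_le.2 ?_)
  rintro _ ⟨i, rfl⟩
  have h : ∀ i, E i + c i • E i₀ ∈ Submodule.span ℤ (Set.range fun i => E i + c i • E i₀) :=
    fun i => Submodule.subset_span ⟨i, rfl⟩
  have h0 := h i₀
  rw [hc, zero_smul, add_zero] at h0
  have := sub_mem (h i) (Submodule.smul_mem _ (c i) h0)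
  rwa [add_sub_cancel_right] at this

/-- Simultaneous shears along `i₀` in the source and in the target preserve a diagonal form when
their coefficients are compatible with the diagonal entries. -/
theorem HasDiagonalForm.shear {n : ℕ} {I : Type*} {D : Module.End ℤ (Fin n → ℤ)} {d : I → ℤ}
    {a b : I → ZMod 2} (h : HasDiagonalForm D d a b) (i₀ : I) (c c' : I → ℤ) (hc : c i₀ = 0)
    (hc' : c' i₀ = 0) (hd : ∀ i, c i * d i₀ = d i * c' i) :
    HasDiagonalForm D d (fun i => a i + c i * a i₀) (fun i => b i + c' i * b i₀) := by
  obtain ⟨E, F, hE, hF, hD, ha, hb⟩ := h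
  refine ⟨_, _, span_add_smul hE hc, span_add_smul hF hc', fun i => ?_, fun i => ?_, fun i => ?_⟩
  · rw [map_add, map_smul, hD, hD, smul_smul, hd, smul_add, smul_smul]
  · rw [map_add, parity_smul, ha, ha]
  · rw [map_add, parity_smul, hb, hb]

/-- A diagonal form on `ℤ^n` with exactly one odd vector in the source and in the target restricts
to a diagonal form on the coroot lattice, in which the entry at the odd vector `i₀` of the source
is doubled and then the entry at the odd vector `j₀` of the target is halved. -/
theorem HasDiagonalForm.hasSmithNormalForm {n : ℕ} (hn : 4 ≤ n) {w : weylGroup n}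
    {T : Module.End ℤ (Fin n → ℤ)} (hw : Realizes w T) {I : Type*} [Fintype I] [DecidableEq I]
    {d d' : I → ℤ} {a b : I → ZMod 2} (h : HasDiagonalForm (1 - T) d a b) (i₀ j₀ : I)
    (ha : ∀ i, a i = if i = i₀ then 1 else 0) (hb : ∀ i, b i = if i = j₀ then 1 else 0)
    (hd : ∀ i, d i * (if i = i₀ then 2 else 1) = d' i * (if i = j₀ then 2 else 1))
    {L : List ℕ} (hlen : L.length = n) (hdvd : L.Pairwise (· ∣ ·))
    (hL : Multiset.map d' Finset.univ.val = ((L.map Nat.cast : List ℤ) : Multiset ℤ)) :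
    HasSmithNormalForm (idSub n w) L := by
  obtain ⟨E, F, hE, hF, hD, hEa, hFb⟩ := h
  obtain ⟨x, hx, hxE⟩ := exists_span_corootLattice hn hE i₀ fun i => (hEa i).trans (ha i)
  obtain ⟨y, hy, hyF⟩ := exists_span_corootLattice hn hF j₀ fun i => (hFb i).trans (hb i)
  refine hasSmithNormalForm_of_span hx hy (fun i => corootEmb_injective hn ?_) hlen hdvd hL
  rw [idSub, LinearMap.toMatrix'_mulVec]
  have hwx := hw (x i)
  simp only [LinearMap.sub_apply, LinearMap.id_apply, LinearEquiv.coe_coe, map_sub, map_smul]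
  rw [hwx, hxE, hyF, smul_smul, ← hd i, mul_comm, mul_smul, ← hD, map_smul, ← smul_sub]
  rfl

/-! ### Diagonal forms of signed permutations -/

theorem parity_stdVec {n z : ℕ} (hz : 1 ≤ z) (hzn : z ≤ n) : parity n (stdVec n z) = 1 := by
  have h := dotProduct_stdVec hz hzn 1
  rw [one_dotProduct] at h
  rw [parity_apply, h]
  rfl

/-- A signed cycle `e_0 ↦ e_1 ↦ ⋯ ↦ e_{m-1} ↦ ε e_0` makes `1 - T` diagonal: it maps `e_i` to
`e_i - e_{i+1}` for `i < m - 1`, and `e_0 + ⋯ + e_{m-1}` to `(1 - ε) e_0`. -/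
theorem hasDiagonalForm_of_cycles {n : ℕ} {K : Type*} {T : Module.End ℤ (Fin n → ℤ)} (m : K → ℕ)
    (hm : ∀ k, 1 ≤ m k) (ε : K → ℤ) (e : K → ℕ → Fin n → ℤ)
    (hT : ∀ k, ∀ i < m k, T (e k i) = if i + 1 < m k then e k (i + 1) else ε k • e k 0)
    (hspan : ∀ N : Submodule ℤ (Fin n → ℤ), (∀ k, ∀ i < m k, e k i ∈ N) → ⊤ ≤ N)
    (hpar : ∀ k, ∀ i < m k, parity n (e k i) = 1) :
    HasDiagonalForm (1 - T) (Sum.elim (fun _ : Σ k, Fin (m k - 1) => 1) fun k => 1 - ε k)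
      (Sum.elim (fun _ => 1) fun k => m k) (Sum.elim (fun _ => 0) fun _ => 1) := by
  refine ⟨Sum.elim (fun x => e x.1 x.2) fun k => ∑ i ∈ Finset.range (m k), e k i,
    Sum.elim (fun x => e x.1 x.2 - e x.1 (x.2 + 1)) fun k => e k 0,
    hspan _ fun k i hi => ?_, hspan _ fun k i hi => ?_, ?_, ?_, ?_⟩
  · generalize hN : Submodule.span ℤ (Set.range (Sum.elim (fun x : Σ k, Fin (m k - 1) => e x.1 x.2)
      fun k => ∑ i ∈ Finset.range (m k), e k i)) = N
    have h1 : ∀ i < m k - 1, e k i ∈ N := fun i hi => by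
      rw [← hN]
      exact Submodule.subset_span ⟨Sum.inl ⟨k, i, hi⟩, rfl⟩
    by_cases h : i < m k - 1
    · exact h1 i h
    · obtain rfl : i = m k - 1 := by omega
      have h2 : ∑ i ∈ Finset.range (m k), e k i ∈ N := by
        rw [← hN]
        exact Submodule.subset_span ⟨Sum.inr k, rfl⟩
      have h3 := Finset.sum_range_succ (e k) (m k - 1)
      rw [Nat.sub_add_cancel (hm k)] at h3
      rw [h3] at h2
      exact (Submodule.add_mem_iff_right _
        (sum_mem fun i hi => h1 i (Finset.mem_range.1 hi))).1 h2
  · generalize hN : Submodule.span ℤ (Set.range (Sum.elim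
      (fun x : Σ k, Fin (m k - 1) => e x.1 x.2 - e x.1 (x.2 + 1)) fun k => e k 0)) = N
    induction i with
    | zero =>
      rw [← hN]
      exact Submodule.subset_span ⟨Sum.inr k, rfl⟩
    | succ i ih =>
      have h : e k i - e k (i + 1) ∈ N := by
        rw [← hN]
        exact Submodule.subset_span ⟨Sum.inl ⟨k, i, by omega⟩, rfl⟩
      simpa using sub_mem (ih (by omega)) h
  · rintro (⟨k, i⟩ | k)
    · have := i.2
      simp only [Sum.elim_inl, LinearMap.sub_apply, Module.End.one_apply, one_smul]
      rw [hT k i (by omega), if_pos (by omega)]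
    · simp only [Sum.elim_inr, LinearMap.sub_apply, Module.End.one_apply, map_sum]
      obtain ⟨l, hl⟩ : ∃ l, m k = l + 1 := ⟨m k - 1, by have := hm k; omega⟩
      rw [hl, Finset.sum_sub_distrib, Finset.sum_range_succ',
        Finset.sum_range_succ (fun i => T (e k i)), hT k l (by omega), if_neg (by omega),
        sub_smul, one_smul]
      have : ∑ i ∈ Finset.range l, T (e k i) = ∑ i ∈ Finset.range l, e k (i + 1) :=
        Finset.sum_congr rfl fun i hi => by
          have := Finset.mem_range.1 hi
          rw [hT k i (by omega), if_pos (by omega)]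
      rw [this, add_sub_add_left_eq_sub]
  · rintro (⟨k, i⟩ | k)
    · exact hpar k i (by omega)
    · simp only [Sum.elim_inr, map_sum]
      rw [Finset.sum_congr rfl fun i hi => hpar k i (Finset.mem_range.1 hi)]
      simp
  · rintro (⟨k, i⟩ | k)
    · simp only [Sum.elim_inl, map_sub]
      rw [hpar k _ (by omega), hpar k _ (by omega), sub_self]
    · exact hpar k 0 (hm k)

theorem exists_eq_partialSum_add (a : List ℕ) {t : ℕ} (ht : t < a.sum) :
    ∃ k < a.length, ∃ i < a.getD k 0, t = partialSum a k + i := by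
  rw [← partialSum_length] at ht
  generalize a.length = K at ht
  induction K with
  | zero => simp [partialSum] at ht
  | succ K ih =>
    by_cases h : t < partialSum a K
    · obtain ⟨k, hk, h⟩ := ih h
      exact ⟨k, by omega, h⟩
    · rw [partialSum_succ] at ht
      exact ⟨K, by omega, t - partialSum a K, by omega, by omega⟩

/-- The lengths of the positive cycles (the parts of `β`) and of the negative cycles (the parts
of `δ`). -/
abbrev cycleLength (β δ : List ℕ) : Fin β.length ⊕ Fin δ.length → ℕ :=
  Sum.elim (fun k => β.getD k 0) fun k => δ.getD k 0

/-- All but one of the elements of each cycle. They index the diagonal entries `1` of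
`1 - w_{β,δ}` on `ℤ^n`; the cycles themselves index the other entries. -/
abbrev CycleRest (β δ : List ℕ) : Type := Σ k, Fin (cycleLength β δ k - 1)

theorem card_cycleRest {β δ : List ℕ} (hβ : ∀ b ∈ β, 1 ≤ b) (hδ : ∀ d ∈ δ, 1 ≤ d) :
    Fintype.card (CycleRest β δ) + β.length + δ.length = β.sum + δ.sum := by
  have h : ∀ a : List ℕ, (∀ x ∈ a, 1 ≤ x) →
      ∑ k : Fin a.length, (a.getD k 0 - 1) + a.length = a.sum := by
    intro a ha
    induction a with
    | nil => simp
    | cons x a ih =>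
      have h1 := ih fun y hy => ha y (List.mem_cons_of_mem _ hy)
      have h2 := ha x List.mem_cons_self
      rw [List.sum_cons, ← h1]
      simp only [List.length_cons, Fin.sum_univ_succ, Fin.val_zero, Fin.val_succ,
        List.getD_cons_zero, List.getD_cons_succ]
      omega
  rw [Fintype.card_sigma]
  simp_rw [Fintype.card_fin]
  rw [Fintype.sum_sum_type]
  simp only [Sum.elim_inl, Sum.elim_inr]
  have := h β hβ
  have := h δ hδ
  omega

theorem exists_hasDiagonalForm_mul {n : ℕ} (hn : 4 ≤ n) {β δ : List ℕ} (hβ : ∀ b ∈ β, 1 ≤ b)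
    (hδ : ∀ d ∈ δ, 1 ≤ d) (hincr : δ.Pairwise (· ≤ ·)) (heven : Even δ.length)
    (hsum : β.sum + δ.sum = n) :
    ∃ T, Realizes (wBeta n β * wDelta n δ) T ∧
      HasDiagonalForm (I := CycleRest β δ ⊕ Fin β.length ⊕ Fin δ.length) (1 - T)
        (Sum.elim (fun _ => 1) (Sum.elim (fun _ => 0) fun _ => 2))
        (Sum.elim (fun _ => 1) (Sum.elim (fun k => (β.getD k 0 : ZMod 2)) fun k => δ.getD k 0))
        (Sum.elim (fun _ => 0) (Sum.elim (fun _ => 1) fun _ => 1)) := by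
  obtain ⟨hB, hB1, hB2⟩ := realizes_wBeta hn hβ (show β.sum ≤ n by omega)
  generalize ((wordBeta β).map (refl n)).prod = S at hB hB1 hB2
  obtain ⟨T, hT, hT1, hT2⟩ := exists_realizes_wDelta hn hδ hincr heven (show δ.sum ≤ n by omega)
  refine ⟨_, hB.mul hT, ?_⟩
  have hm : ∀ a : List ℕ, (∀ x ∈ a, 1 ≤ x) → ∀ k : Fin a.length, 1 ≤ a.getD k 0 := by
    intro a ha k
    rw [List.getD_eq_getElem _ _ k.2]
    exact ha _ (List.getElem_mem _)
  have h := hasDiagonalForm_of_cycles (T := S * T)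
    (cycleLength β δ) (Sum.rec (hm β hβ) (hm δ hδ)) (Sum.elim (fun _ => 1) fun _ => -1)
    (Sum.elim (fun k i => stdVec n (partialSum β k + i + 1))
      fun k i => stdVec n (n - (partialSum δ k + i))) ?_ ?_ ?_
  · have h1 : (Sum.elim (fun _ : CycleRest β δ => 1)
        fun k => 1 - Sum.elim (fun _ => 1) (fun _ => -1) k)
        = (Sum.elim (fun _ => 1) (Sum.elim (fun _ => 0) fun _ => 2) :
          CycleRest β δ ⊕ Fin β.length ⊕ Fin δ.length → ℤ) := by
      ext (x | x | x) <;> rfl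
    have h2 : (Sum.elim (fun _ : CycleRest β δ => 1) fun k => (cycleLength β δ k : ZMod 2))
        = Sum.elim (fun _ => 1) (Sum.elim (fun k : Fin β.length => (β.getD k 0 : ZMod 2))
          fun k : Fin δ.length => (δ.getD k 0 : ZMod 2)) := by
      ext (x | x | x) <;> rfl
    have h3 : (Sum.elim (fun _ : CycleRest β δ => (0 : ZMod 2)) fun _ => 1)
        = Sum.elim (fun _ => 0)
          (Sum.elim (fun _ : Fin β.length => 1) fun _ : Fin δ.length => 1) := by
      ext (x | x | x) <;> rfl
    rwa [h1, h2, h3] at h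
  · rintro (k | k) i hi
    · simp only [Sum.elim_inl] at hi ⊢
      have := partialSum_add_le (a := β) k
      rw [Module.End.mul_apply, hT2 _ (by omega) (by omega), hB1 k k.2 i hi, one_smul,
        apply_ite (stdVec n)]
      rfl
    · simp only [Sum.elim_inr] at hi ⊢
      have := partialSum_add_le (a := δ) k
      have hTi := hT1 k k.2 i hi
      rw [Module.End.mul_apply, hTi]
      by_cases h : i + 1 < δ.getD k 0
      · rw [if_pos h]
        exact (hB2 _ (by omega) (by omega)).trans (if_pos h).symm
      · rw [if_neg h, map_neg, hB2 _ (by omega) (by omega)]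
        exact ((if_neg h).trans (neg_one_smul ℤ _)).symm
  · intro N hN x _
    rw [eq_sum_stdVec x]
    refine sum_mem fun z _ => Submodule.smul_mem _ _ ?_
    by_cases hz : z.1 < β.sum
    · obtain ⟨k, hk, i, hi, h⟩ := exists_eq_partialSum_add β hz
      rw [h]
      exact hN (Sum.inl ⟨k, hk⟩) i hi
    · obtain ⟨k, hk, i, hi, h⟩ :=
        exists_eq_partialSum_add δ (show n - (z.1 + 1) < δ.sum by omega)
      have := hN (Sum.inr ⟨k, hk⟩) i hi
      simp only [Sum.elim_inr] at this
      rwa [← h, show n - (n - (z.1 + 1)) = z.1 + 1 by omega] at this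
  · rintro (k | k) i hi
    · have := partialSum_add_le (a := β) k
      simp only [Sum.elim_inl] at hi ⊢
      exact parity_stdVec (by omega) (by omega)
    · have := partialSum_add_le (a := δ) k
      simp only [Sum.elim_inr] at hi ⊢
      exact parity_stdVec (by omega) (by omega)

/-- The endomorphism of `ℤ^n` that negates the last coordinate. -/
def negLast (n : ℕ) : Module.End ℤ (Fin n → ℤ) where
  toFun x k := if k.1 + 1 = n then -x k else x k
  map_add' x y := by ext k; simp only [Pi.add_apply]; split_ifs <;> ring
  map_smul' c x := by ext k; simp

theorem negLast_mul_self (n : ℕ) : negLast n * negLast n = 1 := by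
  ext1 x
  ext k
  simp only [negLast, LinearMap.comp_apply, Module.End.mul_apply, LinearMap.coe_mk, AddHom.coe_mk]
  split_ifs <;> simp

theorem negLast_stdVec (n z : ℕ) :
    negLast n (stdVec n z) = if z = n then -stdVec n z else stdVec n z := by
  ext k
  simp only [negLast, LinearMap.coe_mk, AddHom.coe_mk, stdVec]
  split_ifs <;> simp [stdVec] <;> omega

theorem parity_negLast {n : ℕ} (x : Fin n → ℤ) : parity n (negLast n x) = parity n x := by
  simp only [parity_apply, Int.cast_sum]
  refine Finset.sum_congr rfl fun k _ => ?_
  simp only [negLast, LinearMap.coe_mk, AddHom.coe_mk]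
  split_ifs
  · rw [Int.cast_neg, ZMod.neg_eq_self_mod_two]
  · rfl

/-- Negation of the last coordinate induces the automorphism of the Dynkin diagram that exchanges
the last two nodes. -/
theorem negLast_conj_refl {n i : ℕ} (hi : 1 ≤ i) (hin : i < n) :
    refl n (if i = n - 1 then n else i) = negLast n * refl n i * negLast n := by
  have h : ∀ z, 1 ≤ z → z ≤ n → refl n (if i = n - 1 then n else i) (stdVec n z) =
      (negLast n * refl n i * negLast n) (stdVec n z) := by
    intro z hz hzn
    rw [Module.End.mul_apply, Module.End.mul_apply, negLast_stdVec, apply_ite (refl n i), map_neg,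
      refl_stdVec hi hin hz hzn, apply_ite (negLast n), map_neg, negLast_stdVec]
    by_cases h : i = n - 1
    · rw [if_pos h, refl_last_stdVec (by omega) hz hzn]
      grind
    · rw [if_neg h, refl_stdVec hi hin hz hzn]
      grind
  refine LinearMap.ext fun x => ?_
  rw [eq_sum_stdVec x, map_sum, map_sum]
  refine Finset.sum_congr rfl fun k _ => ?_
  rw [map_smul, map_smul, h _ (by omega) (by omega)]

/-- An endomorphism of `ℤ^n` is determined by its restriction to the coroot lattice. -/
theorem Realizes.unique {n : ℕ} (hn : 4 ≤ n) {w : weylGroup n} {T T' : Module.End ℤ (Fin n → ℤ)}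
    (h : Realizes w T) (h' : Realizes w T') : T = T' := by
  refine LinearMap.ext fun y => ?_
  -- The coroot lattice contains `2 • y`, although it need not contain `y`.
  obtain ⟨x, hx⟩ := exists_corootEmb_eq hn ((2 : ℤ) • y) (by simp [← Finset.mul_sum])
  have := (h x).symm.trans (h' x)
  rw [hx, map_smul, map_smul] at this
  exact smul_right_injective _ two_ne_zero this

theorem realizes_wBetaMinus {n : ℕ} (hn : 4 ≤ n) {β : List ℕ} (hsum : β.sum ≤ n) :
    Realizes (wBetaMinus n β) (negLast n * ((wordBeta β).map (refl n)).prod * negLast n) := by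
  have hword : ∀ i ∈ wordBeta β, 1 ≤ i ∧ i < n := by
    intro i hi
    simp only [wordBeta, List.mem_flatMap, List.mem_map, List.mem_range] at hi
    obtain ⟨k, hk, j, hj, rfl⟩ := hi
    have := partialSum_add_le (a := β) k
    omega
  have h := realizes_wordProd hn ((wordBeta β).map fun i => if i = n - 1 then n else i)
  suffices hT : ∀ l : List ℕ, (∀ i ∈ l, 1 ≤ i ∧ i < n) →
      ((l.map fun i => if i = n - 1 then n else i).map (refl n)).prod =
        negLast n * (l.map (refl n)).prod * negLast n by
    rwa [hT _ hword] at h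
  clear h hword
  intro l hword
  induction l with
  | nil => simp [negLast_mul_self]
  | cons i l ih =>
    simp only [List.map_cons, List.prod_cons]
    obtain ⟨h1, h2⟩ := hword i List.mem_cons_self
    rw [ih fun j hj => hword j (List.mem_cons_of_mem _ hj), negLast_conj_refl h1 h2]
    simp only [mul_assoc]
    rw [← mul_assoc (negLast n) (negLast n), negLast_mul_self, one_mul]

/-- Negation of the last coordinate preserves parities, so it transports diagonal forms. -/
theorem HasDiagonalForm.conj_negLast {n : ℕ} {I : Type*} {T : Module.End ℤ (Fin n → ℤ)}
    {d : I → ℤ} {a b : I → ZMod 2} (h : HasDiagonalForm (1 - T) d a b) :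
    HasDiagonalForm (1 - negLast n * T * negLast n) d a b := by
  have hN : ∀ x, negLast n (negLast n x) = x := fun x =>
    LinearMap.congr_fun (negLast_mul_self n) x
  have hspan : ∀ G : I → Fin n → ℤ, ⊤ ≤ Submodule.span ℤ (Set.range G) →
      ⊤ ≤ Submodule.span ℤ (Set.range fun i => negLast n (G i)) := by
    intro G hG x _
    have := Submodule.mem_map_of_mem (f := negLast n) (hG (show negLast n x ∈ ⊤ from trivial))
    rwa [hN, Submodule.map_span, ← Set.range_comp] at this
  obtain ⟨E, F, hE, hF, hD, ha, hb⟩ := h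
  refine ⟨_, _, hspan E hE, hspan F hF, fun i => ?_, fun i => ?_, fun i => ?_⟩
  · have := congrArg (negLast n) (hD i)
    rw [map_smul] at this
    rw [← this]
    simp [hN]
  · rw [parity_negLast, ha]
  · rw [parity_negLast, hb]

theorem IsClassRep.exists_hasDiagonalForm {n : ℕ} (hn : 4 ≤ n) {β δ : List ℕ}
    (hβ : ∀ b ∈ β, 1 ≤ b) (hδ : ∀ d ∈ δ, 1 ≤ d) (hincr : δ.Pairwise (· ≤ ·))
    (heven : Even δ.length) (hsum : β.sum + δ.sum = n) {w : weylGroup n}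
    (hw : IsClassRep n β δ w) :
    ∃ T, Realizes w T ∧
      HasDiagonalForm (I := CycleRest β δ ⊕ Fin β.length ⊕ Fin δ.length) (1 - T)
        (Sum.elim (fun _ => 1) (Sum.elim (fun _ => 0) fun _ => 2))
        (Sum.elim (fun _ => 1) (Sum.elim (fun k => (β.getD k 0 : ZMod 2)) fun k => δ.getD k 0))
        (Sum.elim (fun _ => 0) (Sum.elim (fun _ => 1) fun _ => 1)) := by
  obtain ⟨T, hT, h⟩ := exists_hasDiagonalForm_mul hn hβ hδ hincr heven hsum
  rcases hw with rfl | ⟨rfl, -, rfl⟩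
  · exact ⟨T, hT, h⟩
  · have hwT : Realizes (wBeta n β) T := by
      have h1 := hT
      rwa [wDelta, if_pos rfl, mul_one] at h1
    rw [hwT.unique hn (realizes_wordProd hn _)] at h
    exact ⟨_, realizes_wBetaMinus hn (by simpa using hsum.le), h.conj_negLast⟩

/-! ### The Smith normal forms -/

theorem map_update_univ {I : Type*} [Fintype I] [DecidableEq I] {α : Type*} (d : I → α) (i : I)
    (x : α) : d i ::ₘ Multiset.map (Function.update d i x) Finset.univ.val =
      x ::ₘ Multiset.map d Finset.univ.val := by
  have h : (Finset.univ : Finset I).val = i ::ₘ (Finset.univ.erase i).val := by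
    rw [Finset.erase_val, Multiset.cons_erase (Finset.mem_univ i)]
  have h2 : Multiset.map (Function.update d i x) (Finset.univ.erase i).val =
      Multiset.map d (Finset.univ.erase i).val :=
    Multiset.map_congr rfl fun j hj =>
      Function.update_of_ne (Finset.ne_of_mem_erase (Finset.mem_def.2 hj)) _ _
  rw [h, Multiset.map_cons, Multiset.map_cons, Function.update_self, h2, Multiset.cons_swap]

/-- The diagonal entries of `1 - w_{β,δ}` on `ℤ^n`: there is an entry `0` for each positive cycle
and an entry `2` for each negative cycle. -/
abbrev cycleDiag (A P B : Type*) : A ⊕ P ⊕ B → ℤ :=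
  Sum.elim (fun _ => 1) (Sum.elim (fun _ => 0) fun _ => 2)

/-- The values of `cycleDiag`, with their multiplicities. -/
abbrev cycleDiagList (A P B : Type*) [Fintype A] [Fintype P] [Fintype B] : List ℤ :=
  List.replicate (Fintype.card A) 1 ++ (List.replicate (Fintype.card P) 0 ++
    List.replicate (Fintype.card B) 2)

theorem map_cycleDiag {A P B : Type*} [Fintype A] [Fintype P] [Fintype B] :
    Multiset.map (cycleDiag A P B) Finset.univ.val =
    (cycleDiagList A P B : Multiset ℤ) := by
  rw [← Finset.univ_disjSum_univ, ← Finset.univ_disjSum_univ, Finset.val_disjSum,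
    Finset.val_disjSum, Multiset.disjSum, Multiset.disjSum]
  simp [cycleDiagList, ← Multiset.coe_add, Multiset.coe_replicate, Multiset.map_const',
    Function.comp_def]

section Cases

variable {n : ℕ} {A P B : Type*} [DecidableEq A] [DecidableEq P] [DecidableEq B]
  {D : Module.End ℤ (Fin n → ℤ)} {x : P → ZMod 2} {y : B → ZMod 2}

/-- The case in which the odd vectors of the source and of the target have the same index, so that
the diagonal entries do not change. -/
theorem HasDiagonalForm.hasSmithNormalForm_of_eq [Fintype A] [Fintype P] [Fintype B]
    (hn : 4 ≤ n) {w : weylGroup n}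
    {T : Module.End ℤ (Fin n → ℤ)} (hw : Realizes w T) {a b : A ⊕ P ⊕ B → ZMod 2}
    (h : HasDiagonalForm (1 - T) (cycleDiag A P B) a b) (i₀ : A ⊕ P ⊕ B)
    (ha : ∀ i, a i = if i = i₀ then 1 else 0) (hb : ∀ i, b i = if i = i₀ then 1 else 0)
    {L : List ℕ} (hlen : L.length = n) (hdvd : L.Pairwise (· ∣ ·))
    (hL : (L.map Nat.cast).Perm (cycleDiagList A P B)) : HasSmithNormalForm (idSub n w) L :=
  h.hasSmithNormalForm hn hw i₀ i₀ ha hb (fun _ => rfl) hlen hdvd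
    (map_cycleDiag.trans (Multiset.coe_eq_coe.2 hL.symm))

/-- The case in which the odd vectors have different indices: the entry `s` is doubled and the entry
`t * 2` is halved. -/
theorem HasDiagonalForm.hasSmithNormalForm_of_ne [Fintype A] [Fintype P] [Fintype B]
    (hn : 4 ≤ n) {w : weylGroup n}
    {T : Module.End ℤ (Fin n → ℤ)} (hw : Realizes w T) {a b : A ⊕ P ⊕ B → ZMod 2}
    (h : HasDiagonalForm (1 - T) (cycleDiag A P B) a b) {i₀ j₀ : A ⊕ P ⊕ B} (hne : i₀ ≠ j₀)
    (ha : ∀ i, a i = if i = i₀ then 1 else 0) (hb : ∀ i, b i = if i = j₀ then 1 else 0)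
    {s t : ℤ} (hs : cycleDiag A P B i₀ = s) (ht : cycleDiag A P B j₀ = t * 2)
    {L : List ℕ} (hlen : L.length = n) (hdvd : L.Pairwise (· ∣ ·))
    (hL : (s :: (t * 2) :: L.map Nat.cast).Perm ((s * 2) :: t :: cycleDiagList A P B)) :
    HasSmithNormalForm (idSub n w) L := by
  refine h.hasSmithNormalForm hn hw i₀ j₀ ha hb
    (d' := Function.update (Function.update (cycleDiag A P B) i₀ (s * 2)) j₀ t)
    (fun i => ?_) hlen hdvd ?_
  · by_cases h1 : i = j₀
    · subst h1
      simp [hne.symm, ht]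
    · by_cases h2 : i = i₀
      · subst h2
        simp [hne, hs]
      · simp [h1, h2]
  · have h1 := map_update_univ (cycleDiag A P B) i₀ (s * 2)
    have h2 := map_update_univ (Function.update (cycleDiag A P B) i₀ (s * 2)) j₀ t
    rw [Function.update_of_ne hne.symm, ht] at h2
    rw [hs, map_cycleDiag] at h1
    rw [← Multiset.cons_inj_right (t * 2), h2, ← Multiset.cons_inj_right s, Multiset.cons_swap s t,
      h1, Multiset.cons_swap t]
    exact (Multiset.coe_eq_coe.2 hL).symm

theorem zmodTwo_eq_zero_or_one (a : ZMod 2) : a = 0 ∨ a = 1 := by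
  decide +revert

/-- An odd source vector with diagonal entry `0` can be used to make all other source vectors
even. -/
theorem HasDiagonalForm.source_of_zero {I : Type*} [DecidableEq I] {d : I → ℤ} {a b : I → ZMod 2}
    (h : HasDiagonalForm D d a b) (i₀ : I) (hd : d i₀ = 0) (ha : a i₀ = 1) :
    HasDiagonalForm D d (fun i => if i = i₀ then 1 else 0) b := by
  convert h.shear i₀ (fun i => if i = i₀ then 0 else if a i = 1 then 1 else 0) (fun _ => 0)
    (by simp) rfl (by simp [hd]) using 1
  · ext1 i
    by_cases h : i = i₀
    · simp [h, ha]
    · rcases zmodTwo_eq_zero_or_one (a i) with h' | h' <;>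
        simp [h, h', ha, CharTwo.add_self_eq_zero]
  · simp

/-- With the help of a negative cycle, all target vectors but one become even. -/
theorem HasDiagonalForm.target_of_negative
    (h : HasDiagonalForm D (cycleDiag A P B) (Sum.elim (fun _ => 1) (Sum.elim x y))
      (Sum.elim (fun _ => 0) (Sum.elim (fun _ => 1) fun _ => 1))) (j : B) :
    HasDiagonalForm D (cycleDiag A P B)
      (Sum.elim (fun _ => 1) (Sum.elim x fun k => if k = j then y k else y k + y j))
      (fun i => if i = Sum.inr (Sum.inr j) then 1 else 0) := by
  convert h.shear (Sum.inr (Sum.inr j))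
    (Sum.elim (fun _ => 0) (Sum.elim (fun _ => 0) fun k => if k = j then 0 else 1))
    (Sum.elim (fun _ => 0) (Sum.elim (fun _ => 1) fun k => if k = j then 0 else 1))
    (by simp) (by simp) (by rintro (i | i | i) <;> simp [mul_comm]) using 1
  · ext1 (i | i | i)
    · simp
    · simp
    · by_cases hi : i = j <;> simp [hi]
  · ext1 (i | i | i)
    · simp
    · simp [CharTwo.add_self_eq_zero]
    · by_cases hi : i = j <;> simp [hi, CharTwo.add_self_eq_zero]

/-- Without negative cycles, all target vectors but one become even with the help of a positive
cycle. -/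
theorem HasDiagonalForm.target_of_positive [IsEmpty B]
    (h : HasDiagonalForm D (cycleDiag A P B) (Sum.elim (fun _ => 1) (Sum.elim x y))
      (Sum.elim (fun _ => 0) (Sum.elim (fun _ => 1) fun _ => 1))) (j : P) :
    HasDiagonalForm D (cycleDiag A P B) (Sum.elim (fun _ => 1) (Sum.elim x y))
      (fun i => if i = Sum.inr (Sum.inl j) then 1 else 0) := by
  convert h.shear (Sum.inr (Sum.inl j)) (fun _ => 0)
    (Sum.elim (fun _ => 0) (Sum.elim (fun k => if k = j then 0 else 1) isEmptyElim))
    (by simp) (by simp) (by rintro (i | i | i) <;> first | exact isEmptyElim i | simp) using 1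
  · simp
  · ext1 (i | i | i)
    · simp
    · by_cases hi : i = j <;> simp [hi, CharTwo.add_self_eq_zero]
    · exact isEmptyElim i

/-- If all cycles have even length, then one source vector with diagonal entry `1` makes the others
even. -/
theorem HasDiagonalForm.source_of_even {b : A ⊕ P ⊕ B → ZMod 2}
    (h : HasDiagonalForm D (cycleDiag A P B) (Sum.elim (fun _ => 1) (Sum.elim x y)) b)
    (hx : ∀ k, x k = 0) (hy : ∀ k, y k = 0) (i₀ : A) (hb : b (Sum.inl i₀) = 0) :
    HasDiagonalForm D (cycleDiag A P B) (fun i => if i = Sum.inl i₀ then 1 else 0) b := by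
  convert h.shear (Sum.inl i₀)
    (Sum.elim (fun k => if k = i₀ then 0 else 1) fun _ => 0)
    (Sum.elim (fun k => if k = i₀ then 0 else 1) fun _ => 0)
    (by simp) (by simp) (by rintro (i | i | i) <;> simp) using 1
  · ext1 (i | i | i)
    · by_cases hi : i = i₀ <;> simp [hi, CharTwo.add_self_eq_zero]
    · simp [hx]
    · simp [hy]
  · simp [hb]

/-- A negative cycle of odd length makes all other source vectors even, if all positive cycles have
even length. On the target side the shear adds its target vector to those of the other negative
cycles of odd length, so this vector has to be even or there are no such cycles. -/
theorem HasDiagonalForm.source_of_odd {b : A ⊕ P ⊕ B → ZMod 2}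
    (h : HasDiagonalForm D (cycleDiag A P B) (Sum.elim (fun _ => 1) (Sum.elim x y)) b)
    (hx : ∀ k, x k = 0) (i₀ : B) (hy : y i₀ = 1)
    (hb : b (Sum.inr (Sum.inr i₀)) = 0 ∨ ∀ k ≠ i₀, y k = 0) :
    HasDiagonalForm D (cycleDiag A P B) (fun i => if i = Sum.inr (Sum.inr i₀) then 1 else 0) b := by
  convert h.shear (Sum.inr (Sum.inr i₀))
    (Sum.elim (fun _ => 1) (Sum.elim (fun _ => 0)
      fun k => if k = i₀ then 0 else if y k = 1 then 1 else 0))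
    (Sum.elim (fun _ => 2) (Sum.elim (fun _ => 0)
      fun k => if k = i₀ then 0 else if y k = 1 then 1 else 0))
    (by simp) (by simp) (by rintro (i | i | i) <;> simp [mul_comm]) using 1
  · ext1 (i | i | i)
    · simp [hy, CharTwo.add_self_eq_zero]
    · simp [hx]
    · by_cases hi : i = i₀
      · simp [hi, hy]
      · rcases zmodTwo_eq_zero_or_one (y i) with h' | h' <;>
          simp [hi, h', hy, CharTwo.add_self_eq_zero]
  · ext1 (i | i | i)
    · simp [show (2 : ZMod 2) = 0 from rfl]
    · simp
    · rcases hb with hb | hb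
      · simp [hb]
      · by_cases hi : i = i₀
        · simp [hi]
        · simp [hi, hb i hi]

end Cases

theorem gcdTwo_eq (β : List ℕ) : gcdTwo β = if ∀ b ∈ β, Even b then 2 else 1 := by
  induction β with
  | nil => simp [gcdTwo]
  | cons b β ih =>
    have h : gcdTwo (b :: β) = Nat.gcd b (gcdTwo β) := rfl
    rw [h, ih]
    simp only [List.forall_mem_cons]
    by_cases hb : Even b <;> by_cases hβ : ∀ x ∈ β, Even x
    · rw [if_pos hβ, if_pos ⟨hb, hβ⟩]
      exact Nat.gcd_eq_right hb.two_dvd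
    · rw [if_neg hβ, if_neg fun h => hβ h.2, Nat.gcd_one_right]
    · rw [if_pos hβ, if_neg fun h => hb h.1]
      exact Nat.Coprime.gcd_eq_one (Nat.coprime_two_right.2 (Nat.not_even_iff_odd.1 hb))
    · rw [if_neg hβ, if_neg fun h => hβ h.2, Nat.gcd_one_right]

theorem cast_getD_eq_zero {a : List ℕ} (k : Fin a.length) (h : Even a[k]) :
    (a.getD k 0 : ZMod 2) = 0 := by
  rw [List.getD_eq_getElem _ _ k.2]
  exact (ZMod.natCast_eq_zero_iff_even).2 h

theorem cast_getD_eq_one {a : List ℕ} (k : Fin a.length) (h : Odd a[k]) :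
    (a.getD k 0 : ZMod 2) = 1 := by
  rw [List.getD_eq_getElem _ _ k.2]
  exact (ZMod.natCast_eq_one_iff_odd).2 h

theorem wordBeta_eq_nil {β : List ℕ} (h : ∀ b ∈ β, b = 1) : wordBeta β = [] := by
  rw [wordBeta, List.flatMap_eq_nil_iff]
  intro k hk
  rw [List.getD_eq_getElem _ _ (List.mem_range.1 hk), h _ (List.getElem_mem _)]
  rfl

theorem nonempty_cycleRest {β δ : List ℕ}
    (h : (∃ b ∈ β, 2 ≤ b) ∨ ∃ d ∈ δ, 2 ≤ d) : Nonempty (CycleRest β δ) := by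
  rcases h with ⟨b, hb, h2⟩ | ⟨b, hb, h2⟩
  · obtain ⟨k, hk, rfl⟩ := List.getElem_of_mem hb
    refine ⟨⟨Sum.inl ⟨k, hk⟩, 0, ?_⟩⟩
    simp only [cycleLength, Sum.elim_inl, List.getD_eq_getElem _ _ hk]
    omega
  · obtain ⟨k, hk, rfl⟩ := List.getElem_of_mem hb
    refine ⟨⟨Sum.inr ⟨k, hk⟩, 0, ?_⟩⟩
    simp only [cycleLength, Sum.elim_inr, List.getD_eq_getElem _ _ hk]
    omega

theorem hasSmithNormalForm_zero (n : ℕ) :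
    HasSmithNormalForm (0 : Matrix (Fin n) (Fin n) ℤ) (List.replicate n 0) := by
  refine ⟨by simp, List.pairwise_replicate.2 (Or.inr dvd_rfl), 1, 1, ?_⟩
  ext i j
  simp [Matrix.diagonal_apply]

theorem idSub_one (n : ℕ) : idSub n 1 = 0 := by
  rw [idSub, ← map_zero LinearMap.toMatrix']
  congr 1
  exact sub_self _

end TypeD

theorem theorem7p1 (n : ℕ) (hn : 4 ≤ n) (p r : ℕ) (β δ : List ℕ)
    (hβ_len : β.length = p) (hβ_pos : ∀ b ∈ β, 1 ≤ b) (hβ_decr : β.Pairwise (· ≥ ·))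
    (hδ_len : δ.length = 2 * r) (hδ_pos : ∀ d ∈ δ, 1 ≤ d) (hδ_incr : δ.Pairwise (· ≤ ·))
    (hsum : β.sum + δ.sum = n)
    (w : TypeD.weylGroup n) (hw : TypeD.IsClassRep n β δ w) :
    (TypeD.gcdTwo β = 2 → 2 ≤ δ.sum → TypeD.SameParity δ →
      TypeD.HasSmithNormalForm (TypeD.idSub n w)
        (List.replicate (n - 2 * r - p) 1 ++ List.replicate (2 * r) 2 ++ List.replicate p 0)) ∧
    (TypeD.gcdTwo β = 2 → 2 ≤ δ.sum → ¬ TypeD.SameParity δ →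
      TypeD.HasSmithNormalForm (TypeD.idSub n w)
        (List.replicate (n - 2 * r - p + 1) 1 ++ List.replicate (2 * r - 2) 2 ++ [4] ++
          List.replicate p 0)) ∧
    (TypeD.gcdTwo β = 1 → 2 ≤ δ.sum →
      TypeD.HasSmithNormalForm (TypeD.idSub n w)
        (List.replicate (n - 2 * r - p + 1) 1 ++ List.replicate (2 * r - 1) 2 ++
          List.replicate p 0)) ∧
    (δ.sum = 0 → (∀ b ∈ β, b = 1) →
      w = 1 ∧ TypeD.HasSmithNormalForm (TypeD.idSub n w) (List.replicate n 0)) ∧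
    (δ.sum = 0 → ¬ (∀ b ∈ β, b = 1) →
      TypeD.HasSmithNormalForm (TypeD.idSub n w)
        (List.replicate (n - p - 1) 1 ++ [TypeD.gcdTwo β] ++ List.replicate p 0)) := by
  open TypeD in
  obtain ⟨T, hT, h⟩ := hw.exists_hasDiagonalForm hn hβ_pos hδ_pos hδ_incr
    (hδ_len ▸ even_two_mul r) hsum
  obtain ⟨a, hA⟩ : ∃ a, Fintype.card (CycleRest β δ) = a := ⟨_, rfl⟩
  have hcard := card_cycleRest hβ_pos hδ_pos
  rw [hA, hsum] at hcard
  have hnil : δ.sum = 0 → δ = [] := fun h0 => List.eq_nil_iff_forall_not_mem.2 fun d hd => by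
    have := List.le_sum_of_mem hd
    have := hδ_pos d hd
    omega
  have hodd : gcdTwo β = 1 → ∃ k : Fin β.length, Odd β[k] := by
    intro hg
    rw [gcdTwo_eq] at hg
    split_ifs at hg with h0
    · omega
    push Not at h0
    obtain ⟨b, hb, hb'⟩ := h0
    obtain ⟨k, hk, rfl⟩ := List.getElem_of_mem hb
    exact ⟨⟨k, hk⟩, Nat.not_even_iff_odd.1 hb'⟩
  have heven : gcdTwo β = 2 → ∀ k : Fin β.length, (β.getD k 0 : ZMod 2) = 0 := by
    intro hg k
    rw [gcdTwo_eq] at hg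
    split_ifs at hg with h0
    · exact cast_getD_eq_zero k (h0 _ (List.getElem_mem _))
    · omega
  have hB : 2 ≤ δ.sum → 0 < δ.length := fun h2 => List.length_pos_iff.2 fun h0 => by
    simp [h0] at h2
  subst hβ_len
  refine ⟨fun hg h2 hp => ?_, fun hg h2 hp => ?_, fun hg h2 => ?_, fun h0 h1 => ?_,
    fun h0 h1 => ?_⟩
  · have hj := hB h2
    have h' := h.target_of_negative ⟨0, hj⟩
    by_cases he : Even δ[0]
    · have hδe : ∀ k : Fin δ.length, (δ.getD k 0 : ZMod 2) = 0 := fun k =>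
        cast_getD_eq_zero k (by
          have := hp _ (List.getElem_mem k.2) _ (List.getElem_mem hj)
          rw [Nat.even_iff] at he ⊢
          exact this.trans he)
      obtain ⟨i₀⟩ : Nonempty (CycleRest β δ) := nonempty_cycleRest (Or.inr
        ⟨_, List.getElem_mem hj, by
          have := hδ_pos _ (List.getElem_mem hj)
          rw [Nat.even_iff] at he
          omega⟩)
      -- An entry `1` is doubled and an entry `2` is halved.
      have h'' := h'.source_of_even (heven hg)
        (fun k => by rw [hδe, hδe, add_zero, ite_self]) i₀ (by simp)
      refine h''.hasSmithNormalForm_of_ne hn hT (s := 1) (t := 1) (by simp) (fun _ => rfl)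
        (fun _ => rfl) rfl rfl ?_ ?_ ?_
      · simp
        omega
      · simp [List.pairwise_append, List.pairwise_replicate]
      · rw [List.perm_iff_count]
        intro v
        rw [cycleDiagList, hA]
        simp [List.count_cons, List.count_replicate]
        split_ifs <;> omega
    · -- The odd vectors of the source and of the target belong to the same entry `2`.
      have hδo : ∀ k : Fin δ.length, (δ.getD k 0 : ZMod 2) = 1 := fun k =>
        cast_getD_eq_one k (by
          have := hp _ (List.getElem_mem k.2) _ (List.getElem_mem hj)
          rw [Nat.not_even_iff] at he
          exact Nat.odd_iff.2 (this.trans he))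
      have h'' := h'.source_of_odd (heven hg) ⟨0, hj⟩ (by rw [if_pos rfl, hδo])
        (Or.inr fun k hk => by rw [if_neg hk, hδo, hδo]; rfl)
      refine h''.hasSmithNormalForm_of_eq hn hT _ (fun _ => rfl) (fun _ => rfl) ?_ ?_ ?_
      · simp
        omega
      · simp [List.pairwise_append, List.pairwise_replicate]
      · rw [List.perm_iff_count]
        intro v
        rw [cycleDiagList, hA]
        simp [List.count_replicate]
        split_ifs <;> omega
  · obtain ⟨j₀, j₁, h0, h1⟩ : ∃ j₀ j₁ : Fin δ.length, Odd δ[j₀] ∧ Even δ[j₁] := by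
      by_contra! hcon
      refine hp fun a ha b hb => ?_
      obtain ⟨i, hi, rfl⟩ := List.getElem_of_mem ha
      obtain ⟨j, hj, rfl⟩ := List.getElem_of_mem hb
      have h1 := hcon ⟨i, hi⟩ ⟨j, hj⟩
      have h2 := hcon ⟨j, hj⟩ ⟨i, hi⟩
      simp only [Fin.getElem_fin, Nat.odd_iff, Nat.even_iff] at h1 h2
      omega
    have h' := h.target_of_negative j₁
    have hne : j₀ ≠ j₁ := by
      rintro rfl
      exact Nat.not_even_iff_odd.2 h0 h1
    -- One entry `2` is doubled and another one is halved.
    have h'' := h'.source_of_odd (heven hg) j₀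
      (by rw [if_neg hne, cast_getD_eq_one j₀ h0, cast_getD_eq_zero j₁ h1, add_zero])
      (Or.inl (by simp [hne]))
    have hr : 0 < r := by
      have := j₀.2
      omega
    refine h''.hasSmithNormalForm_of_ne hn hT (s := 2) (t := 1) (by simpa using hne) (fun _ => rfl)
      (fun _ => rfl) rfl rfl ?_ ?_ ?_
    · simp
      omega
    · simp [List.pairwise_append, List.pairwise_replicate]
    · rw [List.perm_iff_count]
      intro v
      rw [cycleDiagList, hA]
      simp [List.count_cons, List.count_replicate]
      split_ifs <;> omega
  · have hj := hB h2
    obtain ⟨k₀, hk₀⟩ := hodd hg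
    -- An entry `0` is doubled and an entry `2` is halved.
    have h' := (h.target_of_negative ⟨0, hj⟩).source_of_zero (Sum.inr (Sum.inl k₀)) rfl
      (cast_getD_eq_one k₀ hk₀)
    refine h'.hasSmithNormalForm_of_ne hn hT (s := 0) (t := 1) (by simp) (fun _ => rfl)
      (fun _ => rfl) rfl rfl ?_ ?_ ?_
    · simp
      omega
    · simp [List.pairwise_append, List.pairwise_replicate]
    · rw [List.perm_iff_count]
      intro v
      rw [cycleDiagList, hA]
      simp [List.count_cons, List.count_replicate]
      split_ifs <;> omega
  · obtain rfl := hnil h0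
    have hw1 : w = 1 := by
      rcases hw with rfl | ⟨-, -, rfl⟩
      · rw [wBeta, wordBeta_eq_nil h1, wDelta, if_pos rfl, mul_one]
        rfl
      · rw [wBetaMinus, wordBeta_eq_nil h1]
        rfl
    refine ⟨hw1, ?_⟩
    rw [hw1, idSub_one]
    exact hasSmithNormalForm_zero n
  · obtain rfl := hnil h0
    have : IsEmpty (Fin ([] : List ℕ).length) := Fin.isEmpty
    obtain ⟨b, hb, hb1⟩ : ∃ b ∈ β, b ≠ 1 := by simpa using h1
    have hβ : 0 < β.length := List.length_pos_of_mem hb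
    obtain ⟨i₀⟩ : Nonempty (CycleRest β []) := nonempty_cycleRest (Or.inl
      ⟨b, hb, by have := hβ_pos b hb; omega⟩)
    have ha : 0 < a := hA ▸ Fintype.card_pos_iff.2 ⟨i₀⟩
    replace hcard : a + β.length = n := hcard
    have hg' : gcdTwo β = 2 ∨ gcdTwo β = 1 := by
      rw [gcdTwo_eq]
      split_ifs <;> simp
    rcases hg' with hg | hg
    · -- An entry `1` is doubled and an entry `0` is halved.
      have h' := (h.target_of_positive ⟨0, hβ⟩).source_of_even (heven hg) isEmptyElim i₀ rfl
      rw [hg]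
      refine h'.hasSmithNormalForm_of_ne hn hT (s := 1) (t := 0) (by simp) (fun _ => rfl)
        (fun _ => rfl) rfl rfl ?_ ?_ ?_
      · simp
        omega
      · simp [List.pairwise_append, List.pairwise_replicate]
      · rw [List.perm_iff_count]
        intro v
        rw [cycleDiagList, hA]
        simp [List.count_cons, List.count_replicate]
        split_ifs <;> omega
    · obtain ⟨k₀, hk₀⟩ := hodd hg
      -- The odd vectors of the source and of the target belong to the same entry `0`.
      have h' := (h.target_of_positive k₀).source_of_zero (Sum.inr (Sum.inl k₀)) rfl
        (cast_getD_eq_one k₀ hk₀)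
      rw [hg]
      refine h'.hasSmithNormalForm_of_eq hn hT _ (fun _ => rfl) (fun _ => rfl) ?_ ?_ ?_
      · simp
        omega
      · simp [List.pairwise_append, List.pairwise_replicate]
      · rw [List.perm_iff_count]
        intro v
        rw [cycleDiagList, hA]
        simp [List.count_cons, List.count_replicate]
        split_ifs <;> omega
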